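/- Let $p,q\ge 1$, $\gamma\in[-1,1]$ and let $\tau:[p+q]\to\{1,*\}$ be any type word, where $[n]=\{1,\dots,n\}$. For each $N$ let $(X_{ij})_{i,j=1}^N$ be a complex $N\times N$ Gaussian elliptic matrix of parameter $\gamma$, that is: (1) the diagonal entries $X_{ii}$ and the pairs $(X_{ij},X_{ji})$, $i<j$, form an independent family; (2) the pairs $(X_{ij},X_{ji})$, $i<j$, are i.i.d., centered and Gaussian (jointly in all real and imaginary parts), with $\mathbb E X_{ij}^2=\mathbb E X_{ji}^2=\mathbb E X_{ij}\overline{X}_{ji}=0$, $\mathbb E|X_{ij}|^2=\mathbb E|X_{ji}|^2=1$ and $\mathbb E X_{ij}X_{ji}=\gamma$; (3) the entries $X_{ii}$ are i.i.d., centered and Gaussian (jointly in real and imaginary part), with $\mathbb E|X_{ii}|^2=1$ and $\mathbb E X_{ii}^2=\gamma$. Let $X=N^{-1/2}(X_{ij})_{i,j=1}^N$, write $X^1=X$ and let $X^*$ be the conjugate transpose, and put $$W_1=\operatorname{Tr}\big(X^{\tau(1)}\cdots X^{\tau(p)}\big),\qquad W_2=\operatorname{Tr}\big(X^{\tau(p+1)}\cdots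 X^{\tau(p+q)}\big),$$ with $\operatorname{Tr}$ the unnormalized trace. Then $W_1,W_2$ are square-integrable and $$\lim_{N\to\infty}\big(\mathbb E[W_1W_2]-\mathbb E[W_1]\,\mathbb E[W_2]\big)=\sum_{\pi\in NC_2(p,q)}\gamma^{\,s(\pi;\tau)},\qquad s(\pi;\tau)=\#\{\{x,y\}\in\pi:\tau(x)=\tau(y)\},$$ with the convention $0^0=1$. Here $NC_2(p,q)$ is the set of non-crossing annular pair partitions: place $1,\dots,p$ clockwise on the inner circle and $p+1,\dots,p+q$ counterclockwise on the outer circle of an annulus; $NC_2(p,q)$ consists of the partitions $\pi$ of $[p+q]$ into pairs such that at least one pair joins the two circles and the pairs can be drawn as pairwise disjoint curves inside the annulus. -/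

import Mathlib

open MeasureTheory ProbabilityTheory Filter Topology
open scoped Matrix

/-- The type alphabet `{1, *}`. -/
inductive Letter : Type
  | one : Letter
  | star : Letter
  deriving DecidableEq

/-- The matrix `A ^ c` for a letter `c`: `A ^ 1 = A`, and `A ^ *` is the conjugate transpose. -/
def Matrix.letterPow {N : ℕ} (A : Matrix (Fin N) (Fin N) ℂ) :
    Letter → Matrix (Fin N) (Fin N) ℂ
  | Letter.one => A
  | Letter.star => Aᴴ

/-- `Tr (A ^ τ(1) A ^ τ(2) ⋯ A ^ τ(n))`, the product being taken in this order. -/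
def traceWord {N n : ℕ} (A : Matrix (Fin N) (Fin N) ℂ) (τ : Fin n → Letter) : ℂ :=
  ((List.ofFn fun t : Fin n => A.letterPow (τ t)).prod).trace

section

variable {Ω : Type*} [MeasurableSpace Ω]

/-- A complex `N × N` Gaussian elliptic matrix of parameter `γ`. "Gaussian" for a complex random
variable, or for a pair of them, means jointly Gaussian in the real and imaginary parts. -/
structure IsComplexElliptic {N : ℕ} (γ : ℝ) (P : Measure Ω)
    (X : Ω → Matrix (Fin N) (Fin N) ℂ) : Prop where
  measurable : ∀ i j, Measurable fun ω => X ω i j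
  /-- The diagonal entries and the pairs `(X i j, X j i)`, `i < j`, are independent. (A diagonal
  entry appears as the pair `(X i i, X i i)`, which generates the same σ-algebra.) -/
  indep : iIndepFun
    (fun (e : {e : Fin N × Fin N // e.1 ≤ e.2}) (ω : Ω) =>
      ((X ω e.1.1 e.1.2, X ω e.1.2 e.1.1) : ℂ × ℂ)) P
  centered : ∀ i j, ∫ ω, X ω i j ∂P = 0
  gaussian_offDiag : ∀ i j, i < j → HasGaussianLaw (fun ω => ((X ω i j, X ω j i) : ℂ × ℂ)) P
  identDistrib_offDiag : ∀ i j k l, i < j → k < l →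
    IdentDistrib (fun ω => ((X ω i j, X ω j i) : ℂ × ℂ))
      (fun ω => ((X ω k l, X ω l k) : ℂ × ℂ)) P P
  sq_offDiag : ∀ i j, i < j → ∫ ω, X ω i j ^ 2 ∂P = 0 ∧ ∫ ω, X ω j i ^ 2 ∂P = 0
  mul_conj_offDiag : ∀ i j, i < j → ∫ ω, X ω i j * (starRingEnd ℂ) (X ω j i) ∂P = 0
  normSq_offDiag : ∀ i j, i < j →
    ∫ ω, ‖X ω i j‖ ^ 2 ∂P = 1 ∧ ∫ ω, ‖X ω j i‖ ^ 2 ∂P = 1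
  mul_offDiag : ∀ i j, i < j → ∫ ω, X ω i j * X ω j i ∂P = (γ : ℂ)
  gaussian_diag : ∀ i, HasGaussianLaw (fun ω => X ω i i) P
  identDistrib_diag : ∀ i k, IdentDistrib (fun ω => X ω i i) (fun ω => X ω k k) P P
  normSq_diag : ∀ i, ∫ ω, ‖X ω i i‖ ^ 2 ∂P = 1
  sq_diag : ∀ i, ∫ ω, X ω i i ^ 2 ∂P = (γ : ℂ)

/-- The covariance `κ₂(ξ₁, ξ₂) = E(ξ₁ ξ₂) - E(ξ₁) E(ξ₂)` of complex random variables (bilinear,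
without conjugation). -/
noncomputable def kappa₂ (P : Measure Ω) (ξ₁ ξ₂ : Ω → ℂ) : ℂ :=
  ∫ ω, ξ₁ ω * ξ₂ ω ∂P - (∫ ω, ξ₁ ω ∂P) * ∫ ω, ξ₂ ω ∂P

end

/-- The normalized matrix `N ^ (-1/2) A`. -/
noncomputable def normalizedMatrix {N : ℕ} (A : Matrix (Fin N) (Fin N) ℂ) :
    Matrix (Fin N) (Fin N) ℂ :=
  (((Real.sqrt N)⁻¹ : ℝ) : ℂ) • A

/-- `π` is a pair partition, written as the permutation that exchanges the two points of each
block. -/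
def IsPairing {n : ℕ} (π : Equiv.Perm (Fin n)) : Prop :=
  ∀ x, π x ≠ x ∧ π (π x) = x

/-- `{x, y}` is a spoke of `π`: `x` lies on the inner circle (the points `0, …, p - 1`), `y` on the
outer circle (the points `p, …, p + q - 1`), and `π` pairs them. -/
def IsSpoke (p q : ℕ) (π : Equiv.Perm (Fin (p + q))) (x y : Fin (p + q)) : Prop :=
  x.val < p ∧ p ≤ y.val ∧ π x = y

/-- The inner points stand clockwise on the inner circle, the outer points counterclockwise on the
outer circle of an annulus. For `x` inner and `y` outer, cutting the annulus along a curve from `x`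
to `y` leaves a disc; going round its boundary one meets, after `x`, the inner points in the order
`x + 1, x + 2, …, x + p - 1` (cyclically in the inner circle), then `x` again, then `y`, then the
outer points in the order `y + 1, y + 2, …, y + q - 1` (cyclically in the outer circle), then `y`
again. `cutPos p q x y z` is the position of the point `z` along this boundary. -/
def cutPos (p q : ℕ) (x y z : Fin (p + q)) : ℕ :=
  if z.val < p then (z.val + p - x.val) % p else p + (z.val + q - y.val) % q

/-- Non-crossing annular pair partitions: `π` is a pair partition with at least one spoke, and no
two of its pairs cross in the annulus. The chords are disjoint from each spoke `{x, y}`, so they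
are drawn in the disc left by cutting along it; there two chords `{a, π a}`, `{b, π b}` cross
exactly when their endpoints alternate along the boundary. -/
def IsNCAnnularPairing (p q : ℕ) (π : Equiv.Perm (Fin (p + q))) : Prop :=
  IsPairing π ∧ (∃ x y, IsSpoke p q π x y) ∧
    ∀ x y, IsSpoke p q π x y → ¬ ∃ a b : Fin (p + q),
      (a ≠ x ∧ a ≠ y ∧ b ≠ x ∧ b ≠ y) ∧
      cutPos p q x y a < cutPos p q x y b ∧
      cutPos p q x y b < cutPos p q x y (π a) ∧
      cutPos p q x y (π a) < cutPos p q x y (π b)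

instance {n : ℕ} (π : Equiv.Perm (Fin n)) : Decidable (IsPairing π) :=
  inferInstanceAs (Decidable (∀ x, π x ≠ x ∧ π (π x) = x))

instance (p q : ℕ) (π : Equiv.Perm (Fin (p + q))) (x y : Fin (p + q)) :
    Decidable (IsSpoke p q π x y) :=
  inferInstanceAs (Decidable (x.val < p ∧ p ≤ y.val ∧ π x = y))

instance (p q : ℕ) : DecidablePred (IsNCAnnularPairing p q) := fun π => by
  unfold IsNCAnnularPairing
  infer_instance

/-- `NC₂(p, q)`, the finite set of non-crossing annular pair partitions. -/
def NC₂ (p q : ℕ) : Finset (Equiv.Perm (Fin (p + q))) :=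
  Finset.univ.filter (IsNCAnnularPairing p q)

/-- `s(π; τ)`, the number of pairs `{x, y}` of `π` with `τ x = τ y` (each pair is counted once,
at its smaller element). -/
def sameTypePairs {n : ℕ} (π : Equiv.Perm (Fin n)) (τ : Fin n → Letter) : ℕ :=
  (Finset.univ.filter fun x => x < π x ∧ τ x = τ (π x)).card

/-! Expand both traces into sums over index labellings `i` and apply the Wick formula. The product
E[W₁]E[W₂] is an expectation over two independent copies of the matrix, where only pairings without
a spoke survive. It therefore cancels exactly those pairings in E[W₁W₂], and the covariance is a sum
over pairings `π` with a spoke (`IsComplexElliptic.kappa₂_traceWord`).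

The covariance of two entries of `X` or `Xᴴ` has the same index constraint for all types; only the
weight, γ or 1, depends on whether the types agree. So `π` contributes γ^s(π;τ) times the number of
labellings constant on the cycles of `σ * π`, where `σ` is the rotation of both circles. This number
is N to the number of cycles of `σ * π`.

After normalization by N^(-(p+q)/2), it remains to compare this count with N^((p+q)/2). Cutting
along a spoke {x, y} turns `σ` into one long cycle `swap x y * σ`, and the other chords act on it as
transpositions. If none cross, each one splits a cycle and contributes a factor N, which gives
N^((p+q)/2) (`IsNCAnnularPairing.card_invariantFunctions`). If two cross, one of them joins cycles
and at least one factor N is lost (`card_invariantFunctions_le_of_not_isNCAnnularPairing`). In the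
limit only the non-crossing pairings remain, with coefficient 1.

Labellings are counted directly, not through cycle counts: translating values in an additive group
shows how a transposition changes the count. -/

section GaussianMoments

/-! ### Moments of Gaussian vectors and integration by parts -/

variable {E : Type*} [NormedAddCommGroup E] [NormedSpace ℝ E] [CompleteSpace E]
  [SecondCountableTopology E] [MeasurableSpace E] [BorelSpace E]

open scoped ENNReal in
/-- Products of continuous linear functionals of a Gaussian vector have all moments. -/
theorem memLp_prod_clm (μ : Measure E) [IsGaussian μ] {ι : Type*} (S : Finset ι)
    (L : ι → E →L[ℝ] ℂ) (p : ℝ≥0∞) (hp : p ≠ ∞) :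
    MemLp (fun x => ∏ k ∈ S, L k x) p μ := by
  classical
  induction S using Finset.induction_on generalizing p with
  | empty => simpa using memLp_const (1 : ℂ)
  | insert a S ha ih =>
    simp only [Finset.prod_insert ha]
    have h2 : 2 * p ≠ ∞ := ENNReal.mul_ne_top (by simp) hp
    -- Hölder with exponents (2p, 2p) doubles the exponent for the remaining factors, hence the
    -- induction over all finite exponents.
    have : ENNReal.HolderTriple (2 * p) (2 * p) p := ⟨by
      rw [← two_mul, ENNReal.mul_inv (by simp) (by simp), ← mul_assoc,
        ENNReal.mul_inv_cancel (by simp) (by simp), one_mul]⟩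
    have h1 : MemLp (fun x => L a x) (2 * p) μ :=
      (L a).comp_memLp' (IsGaussian.memLp_id μ (2 * p) h2)
    exact (ih (2 * p) h2).mul' h1

theorem integrable_prod_clm (μ : Measure E) [IsGaussian μ] {ι : Type*} (S : Finset ι)
    (L : ι → E →L[ℝ] ℂ) : Integrable (fun x => ∏ k ∈ S, L k x) μ :=
  memLp_one_iff_integrable.1 (memLp_prod_clm μ S L 1 (by simp))

theorem integrable_mul_prod_clm (μ : Measure E) [IsGaussian μ] {ι : Type*} (S : Finset ι)
    (L₀ : E →L[ℝ] ℂ) (L : ι → E →L[ℝ] ℂ) : Integrable (fun x => L₀ x * ∏ k ∈ S, L k x) μ := by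
  have := integrable_prod_clm μ (Finset.insertNone S) (fun k => k.elim L₀ L)
  simpa using this

/-- **Gaussian integration by parts** for products of linear functionals. -/
theorem integral_mul_prod_clm (μ : Measure E) [IsGaussian μ] (hμ : ∫ x, x ∂μ = 0)
    {ι : Type*} [DecidableEq ι] (S : Finset ι) (L₀ : E →L[ℝ] ℂ) (L : ι → E →L[ℝ] ℂ) :
    ∫ x, L₀ x * ∏ k ∈ S, L k x ∂μ =
      ∑ b ∈ S, (∫ x, L₀ x * L b x ∂μ) * ∫ x, ∏ k ∈ S.erase b, L k x ∂μ := by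
  -- Take two independent copies and rotate them by θ, which preserves their joint law. `A T` and `B
  -- T` are the terms of the expanded product in which the factors in `T` see the second copy, and
  -- `L₀` sees the first or the second copy respectively.
  set A : Finset ι → ℂ := fun T => ∫ z : E × E, L₀ z.1 *
    ((∏ k ∈ T, L k z.2) * ∏ k ∈ S \ T, L k z.1) ∂(μ.prod μ) with hA
  set B : Finset ι → ℂ := fun T => ∫ z : E × E, L₀ z.2 *
    ((∏ k ∈ T, L k z.2) * ∏ k ∈ S \ T, L k z.1) ∂(μ.prod μ) with hB
  have prodEq : ∀ T, T ⊆ S → ∀ z : E × E, (∏ k ∈ T, L k z.2) * ∏ k ∈ S \ T, L k z.1 =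
      ∏ k ∈ S, (if k ∈ T then (L k).comp (ContinuousLinearMap.snd ℝ E E)
        else (L k).comp (ContinuousLinearMap.fst ℝ E E)) z := by
    intro T hT z
    rw [← Finset.prod_sdiff hT, mul_comm]
    congr 1
    · refine Finset.prod_congr rfl fun k hk => ?_
      rw [if_neg (Finset.mem_sdiff.1 hk).2]; rfl
    · refine Finset.prod_congr rfl fun k hk => ?_
      rw [if_pos hk]; rfl
  have iA : ∀ T, T ⊆ S → Integrable (fun z : E × E => L₀ z.1 *
      ((∏ k ∈ T, L k z.2) * ∏ k ∈ S \ T, L k z.1)) (μ.prod μ) := by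
    intro T hT
    simp only [prodEq T hT]
    exact integrable_mul_prod_clm (μ.prod μ) S (L₀.comp (ContinuousLinearMap.fst ℝ E E)) _
  have iB : ∀ T, T ⊆ S → Integrable (fun z : E × E => L₀ z.2 *
      ((∏ k ∈ T, L k z.2) * ∏ k ∈ S \ T, L k z.1)) (μ.prod μ) := by
    intro T hT
    simp only [prodEq T hT]
    exact integrable_mul_prod_clm (μ.prod μ) S (L₀.comp (ContinuousLinearMap.snd ℝ E E)) _
  have hL₀ : ∫ x, L₀ x ∂μ = 0 := by
    have := L₀.integral_comp_comm (IsGaussian.integrable_id (μ := μ))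
    simp only [id] at this
    rw [this, hμ, map_zero]
  -- Here t = tan θ, after division by (cos θ)^(|S|+1). The unrotated integral vanishes because `L₀`
  -- is centered and independent of the other factors.
  have hrot : ∀ t : ℝ, ∑ T ∈ S.powerset, (t : ℂ) ^ T.card * (-(t : ℂ) * A T + B T) = 0 := by
    intro t
    set θ := Real.arctan t
    have hc : Real.cos θ ≠ 0 := (Real.cos_arctan_pos t).ne'
    have hs : Real.sin θ = t * Real.cos θ := by
      have := Real.tan_arctan t
      rw [Real.tan_eq_sin_div_cos, div_eq_iff hc] at this
      exact this
    have h0 : ∫ z : E × E, L₀ z.2 * ∏ k ∈ S, L k z.1 ∂(μ.prod μ) = 0 := by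
      have := integral_prod_mul (μ := μ) (ν := μ) (fun z => ∏ k ∈ S, L k z) (fun z => L₀ z)
      simp only [mul_comm (L₀ _)]
      rw [this, hL₀, mul_zero]
    have h1 := IsGaussian.map_rotation_eq_self (μ := μ) (by simpa using hμ) θ
    have h2 : ∫ z : E × E, L₀ (ContinuousLinearMap.rotation θ z).2 *
        ∏ k ∈ S, L k (ContinuousLinearMap.rotation θ z).1 ∂(μ.prod μ) = 0 := by
      rw [← h1, integral_map (by fun_prop)] at h0
      · exact h0
      · refine Continuous.aestronglyMeasurable ?_
        fun_prop
    have h3 : ∀ z : E × E, L₀ (ContinuousLinearMap.rotation θ z).2 *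
        ∏ k ∈ S, L k (ContinuousLinearMap.rotation θ z).1 =
        (Real.cos θ : ℂ) ^ (S.card + 1) * ∑ T ∈ S.powerset, (t : ℂ) ^ T.card *
          (-(t : ℂ) * (L₀ z.1 * ((∏ k ∈ T, L k z.2) * ∏ k ∈ S \ T, L k z.1)) +
            (L₀ z.2 * ((∏ k ∈ T, L k z.2) * ∏ k ∈ S \ T, L k z.1))) := by
      intro z
      have e1 : L₀ (ContinuousLinearMap.rotation θ z).2 =
          (Real.cos θ : ℂ) * (-(t : ℂ) * L₀ z.1 + L₀ z.2) := by
        simp only [ContinuousLinearMap.rotation_apply, map_add, map_smul, Complex.real_smul, hs]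
        push_cast; ring
      have e2 : ∀ k, L k (ContinuousLinearMap.rotation θ z).1 =
          (Real.cos θ : ℂ) * ((t : ℂ) * L k z.2 + L k z.1) := by
        intro k
        simp only [ContinuousLinearMap.rotation_apply, map_add, map_smul, Complex.real_smul, hs]
        push_cast; ring
      simp only [e1, e2, Finset.prod_mul_distrib, Finset.prod_const, Finset.prod_add]
      rw [pow_succ, Finset.mul_sum, Finset.mul_sum, Finset.mul_sum]
      refine Finset.sum_congr rfl fun T _ => ?_
      ring
    simp only [h3] at h2
    rw [integral_const_mul, mul_eq_zero] at h2
    have h4 := h2.resolve_left (pow_ne_zero _ (by exact_mod_cast hc))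
    rw [integral_finsetSum] at h4
    · rw [← h4]
      refine Finset.sum_congr rfl fun T hT => ?_
      rw [Finset.mem_powerset] at hT
      rw [integral_const_mul, integral_add ((iA T hT).const_mul _) (iB T hT), integral_const_mul]
    · intro T hT
      rw [Finset.mem_powerset] at hT
      exact (((iA T hT).const_mul _).add (iB T hT)).const_mul _
  open Polynomial in
  have hpoly : ∑ T ∈ S.powerset, (X : ℂ[X]) ^ T.card * (-X * C (A T) + C (B T)) = 0 := by
    refine Polynomial.eq_zero_of_infinite_isRoot _ ?_
    refine Set.Infinite.mono ?_ (Set.infinite_range_of_injective Complex.ofReal_injective)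
    rintro _ ⟨t, rfl⟩
    simp only [Set.mem_ofPred_eq, IsRoot.def, eval_finsetSum, eval_mul, eval_pow, eval_X, eval_add,
      eval_neg, eval_C]
    exact hrot t
  -- The linear coefficient in t is the integration by parts formula: it involves only `A ∅` and the
  -- `B {b}`.
  have hcoeff := congrArg (fun p => Polynomial.coeff p 1) hpoly
  have hc1 : ∀ T ∈ S.powerset,
      ((Polynomial.X : Polynomial ℂ) ^ T.card *
        (-Polynomial.X * Polynomial.C (A T) + Polynomial.C (B T))).coeff 1 =
        (if T = ∅ then -A T else 0) + if T.card = 1 then B T else 0 := by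
    intro T _
    rw [mul_comm, Polynomial.coeff_mul_X_pow']
    rcases Nat.lt_trichotomy T.card 1 with h | h | h
    · have : T = ∅ := by simpa using h
      subst this
      simp [Polynomial.coeff_C]
    · have : T ≠ ∅ := by rintro rfl; simp at h
      simp [h, this]
    · have : T ≠ ∅ := by rintro rfl; simp at h
      simp [this, h.ne', not_le.2 h]
  simp only [Polynomial.finsetSum_coeff, Polynomial.coeff_zero] at hcoeff
  rw [Finset.sum_congr rfl hc1, Finset.sum_add_distrib, Finset.sum_ite_eq', if_pos (by simp),
    ← Finset.sum_filter, ← Finset.powersetCard_eq_filter, Finset.powersetCard_one,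
    Finset.sum_map, neg_add_eq_zero] at hcoeff
  have hA0 : A ∅ = ∫ x, L₀ x * ∏ k ∈ S, L k x ∂μ := by
    have := integral_prod_mul (μ := μ) (ν := μ) (fun z => L₀ z * ∏ k ∈ S, L k z) (fun _ => 1)
    simpa [hA] using this
  rw [← hA0, hcoeff]
  refine Finset.sum_congr rfl fun b _ => ?_
  have := integral_prod_mul (μ := μ) (ν := μ) (fun z => ∏ k ∈ S.erase b, L k z)
    (fun z => L₀ z * L b z)
  rw [mul_comm, ← this]
  simp only [hB, Function.Embedding.coeFn_mk, Finset.prod_singleton, Finset.sdiff_singleton_eq_erase]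
  congr 1 with z
  ring

end GaussianMoments

/-! ### Pair partitions as involutions with prescribed support -/

section Involutions

open Equiv

variable {ι : Type*} [Fintype ι] [DecidableEq ι]

/-- The involutions whose support is exactly `S`, i.e. the pair partitions of `S`. -/
def involutionsOn (S : Finset ι) : Finset (Perm ι) :=
  Finset.univ.filter fun π => (∀ x, π (π x) = x) ∧ ∀ x, π x ≠ x ↔ x ∈ S

theorem mem_involutionsOn {S : Finset ι} {π : Perm ι} :
    π ∈ involutionsOn S ↔ (∀ x, π (π x) = x) ∧ ∀ x, π x ≠ x ↔ x ∈ S := by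
  simp [involutionsOn]

theorem involutionsOn_empty : involutionsOn (∅ : Finset ι) = {1} := by
  ext π
  rw [mem_involutionsOn, Finset.mem_singleton]
  constructor
  · rintro ⟨-, h⟩
    ext x
    simpa using h x
  · rintro rfl
    simp

theorem mul_swap_mem_involutionsOn_erase {S : Finset ι} {π : Perm ι} (hπ : π ∈ involutionsOn S)
    (a : ι) : π * swap a (π a) ∈ involutionsOn ((S.erase a).erase (π a)) := by
  obtain ⟨h1, h2⟩ := mem_involutionsOn.1 hπ
  rw [mem_involutionsOn]
  have key : ∀ x, (π * swap a (π a)) x = if x = a ∨ x = π a then x else π x := by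
    intro x
    rw [Perm.mul_apply, swap_apply_def]
    split_ifs with h3 h4 h5 h6 h7
    all_goals grind
  refine ⟨fun x => ?_, fun x => ?_⟩
  · simp only [key]
    split_ifs with h3 h4
    · rfl
    · rcases h4 with h4 | h4
      · exact absurd (Or.inr (by rw [← h4, h1])) h3
      · exact absurd (Or.inl (π.injective h4)) h3
    · exact h1 x
  · simp only [key, Finset.mem_erase]
    split_ifs with h3
    · simp only [ne_eq, not_true_eq_false, false_iff]; tauto
    · rw [h2]; tauto

theorem mul_swap_mem_involutionsOn {S : Finset ι} {π : Perm ι} {a b : ι} (ha : a ∈ S)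
    (hb : b ∈ S) (hab : a ≠ b) (hπ : π ∈ involutionsOn ((S.erase a).erase b)) :
    π * swap a b ∈ involutionsOn S ∧ (π * swap a b) a = b := by
  obtain ⟨h1, h2⟩ := mem_involutionsOn.1 hπ
  have ha' : π a = a := by
    by_contra h; rw [← ne_eq, h2] at h; simp at h
  have hb' : π b = b := by
    by_contra h; rw [← ne_eq, h2] at h; simp at h
  have key : ∀ x, (π * swap a b) x = if x = a then b else if x = b then a else π x := by
    intro x
    rw [Perm.mul_apply, swap_apply_def]
    split_ifs <;> simp_all
  have h2' := h2
  simp only [Finset.mem_erase] at h2'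
  have hinj := π.injective
  refine ⟨mem_involutionsOn.2 ⟨fun x => ?_, fun x => ?_⟩, by simp [key]⟩
  · simp only [key]
    split_ifs with h3 h4 h5 h6 h7
    all_goals first | rfl | grind
  · rw [key]
    split_ifs with h3 h4
    · subst h3; simp [ha, hab.symm]
    · subst h4; simp [hb, hab]
    · rw [h2']; tauto

/-- Sorting pairings by the partner `b` of a marked point `a` and deleting that chord gives the
recursion that matches integration by parts. -/
theorem sum_involutionsOn {M : Type*} [AddCommMonoid M] {S : Finset ι} {a : ι} (ha : a ∈ S)
    (f : Perm ι → M) :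
    ∑ π ∈ involutionsOn S, f π =
      ∑ b ∈ S.erase a, ∑ π ∈ involutionsOn ((S.erase a).erase b), f (π * swap a b) := by
  have hmaps : ∀ π ∈ involutionsOn S, π a ∈ S.erase a := by
    intro π hπ
    obtain ⟨h1, h2⟩ := mem_involutionsOn.1 hπ
    have h3 : π a ≠ a := (h2 a).2 ha
    refine Finset.mem_erase.2 ⟨h3, (h2 _).1 ?_⟩
    rw [h1]; exact h3.symm
  rw [← Finset.sum_fiberwise_of_maps_to hmaps]
  refine Finset.sum_congr rfl fun b hb => ?_
  obtain ⟨hb1, hb2⟩ := Finset.mem_erase.1 hb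
  refine Finset.sum_nbij' (fun π => π * swap a b) (fun π => π * swap a b) ?_ ?_ ?_ ?_ ?_
  · intro π hπ
    obtain ⟨hπS, rfl⟩ := Finset.mem_filter.1 hπ
    exact mul_swap_mem_involutionsOn_erase hπS a
  · intro π hπ
    exact Finset.mem_filter.2 (mul_swap_mem_involutionsOn ha hb2 hb1.symm hπ)
  · intro π _
    simp [mul_assoc]
  · intro π _
    simp [mul_assoc]
  · intro π _
    simp [mul_assoc]

end Involutions

/-! ### The Wick formula, for one Gaussian vector and for two independent copies -/

section Wick

variable {E : Type*} [NormedAddCommGroup E] [NormedSpace ℝ E] [CompleteSpace E]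
  [SecondCountableTopology E] [MeasurableSpace E] [BorelSpace E]

/-- The **Wick formula**, also known as the Isserlis theorem. -/
theorem integral_prod_clm_eq_sum_involutionsOn (μ : Measure E) [IsGaussian μ]
    (hμ : ∫ x, x ∂μ = 0) {ι : Type*} [Fintype ι] [LinearOrder ι] (L : ι → E →L[ℝ] ℂ)
    (S : Finset ι) :
    ∫ x, ∏ k ∈ S, L k x ∂μ =
      ∑ π ∈ involutionsOn S, ∏ k ∈ S with k < π k, ∫ x, L k x * L (π k) x ∂μ := by
  induction S using Finset.strongInduction with
  | H S ih =>
    rcases S.eq_empty_or_nonempty with rfl | hS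
    · simp [involutionsOn_empty]
    -- The minimum is used so that the deleted chord {a, b} is counted at `a` in the product over `k
    -- < π k`.
    obtain ⟨a, ha, hmin⟩ : ∃ a ∈ S, ∀ k ∈ S, a ≤ k :=
      ⟨S.min' hS, S.min'_mem hS, fun k hk => S.min'_le k hk⟩
    rw [sum_involutionsOn ha]
    simp only [← Finset.mul_prod_erase S _ ha]
    rw [integral_mul_prod_clm μ hμ]
    refine Finset.sum_congr rfl fun b hb => ?_
    obtain ⟨hba, hbS⟩ := Finset.mem_erase.1 hb
    rw [ih _ ((Finset.erase_ssubset hb).trans (Finset.erase_ssubset ha)), Finset.mul_sum]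
    refine Finset.sum_congr rfl fun π hπ => ?_
    obtain ⟨h1, h2⟩ := mem_involutionsOn.1 hπ
    obtain ⟨hmem, h3⟩ := mul_swap_mem_involutionsOn ha hbS hba.symm hπ
    have h4 : (π * Equiv.swap a b) b = a := by
      have := (mem_involutionsOn.1 hmem).1 a
      rwa [h3] at this
    have h5 : ∀ x, x ≠ a → x ≠ b → (π * Equiv.swap a b) x = π x := by
      intro x hxa hxb
      rw [Equiv.Perm.mul_apply, Equiv.swap_apply_of_ne_of_ne hxa hxb]
    have hfil : (S.filter fun k => k < (π * Equiv.swap a b) k) =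
        insert a (((S.erase a).erase b).filter fun k => k < π k) := by
      ext k
      simp only [Finset.mem_filter, Finset.mem_insert, Finset.mem_erase]
      rcases eq_or_ne k a with rfl | hka
      · simp [ha, h3, lt_of_le_of_ne (hmin b hbS) hba.symm]
      rcases eq_or_ne k b with rfl | hkb
      · simp [h4, hka, hmin k hbS]
      · simp [h5 k hka hkb, hka, hkb]
    rw [hfil, Finset.prod_insert (by simp), h3]
    congr 1
    refine Finset.prod_congr rfl fun k hk => ?_
    simp only [Finset.mem_filter, Finset.mem_erase] at hk
    rw [h5 k hk.1.2.1 hk.1.1]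

/-- The **Wick formula** for functionals of two independent copies of a centered Gaussian vector:
only the pairings that respect the two copies contribute. -/
theorem integral_prod_clm_prod_eq_sum_involutionsOn {Ω : Type*} [MeasurableSpace Ω]
    (P : Measure Ω) [IsProbabilityMeasure P] {Z : Ω → E} (hZ : Measurable Z)
    (hG : HasGaussianLaw Z P) (hmean : ∫ x, x ∂(P.map Z) = 0) {ι : Type*} [Fintype ι]
    [LinearOrder ι] (L : ι → E →L[ℝ] ℂ) (s : ι → Prop) [DecidablePred s] :
    ∫ w : Ω × Ω, ∏ k, L k (Z (if s k then w.1 else w.2)) ∂(P.prod P) =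
      ∑ π ∈ involutionsOn (Finset.univ : Finset ι) with ∀ k, s k ↔ s (π k),
        ∏ k with k < π k, ∫ x, L k x * L (π k) x ∂(P.map Z) := by
  have hGμ := hG.isGaussian_map
  set μ := P.map Z with hμ
  set L' : ι → E × E →L[ℝ] ℂ := fun k =>
    if s k then (L k).comp (ContinuousLinearMap.fst ℝ E E)
    else (L k).comp (ContinuousLinearMap.snd ℝ E E) with hL'
  have hL'a : ∀ k w, L' k w = L k (if s k then w.1 else w.2) := by
    intro k w
    simp only [hL']
    split_ifs <;> rfl
  have hzero : ∀ k, ∫ x, L k x ∂μ = 0 := by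
    intro k
    have := (L k).integral_comp_comm (IsGaussian.integrable_id (μ := μ))
    simp only [id] at this
    rw [this, hmean, map_zero]
  have hmean2 : ∫ z, z ∂(μ.prod μ) = 0 := by
    have hi : Integrable (fun z : E => z) μ := IsGaussian.integrable_id (μ := μ)
    have h := integral_pair (hi.comp_fst μ) (hi.comp_snd μ)
    simp only [Prod.mk.eta] at h
    rw [h, integral_fun_fst (fun z : E => z), integral_fun_snd (fun z : E => z), hmean, smul_zero]
    rfl
  have hmap : (P.prod P).map (Prod.map Z Z) = μ.prod μ :=
    (Measure.map_prod_map P P hZ hZ).symm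
  have h := integral_prod_clm_eq_sum_involutionsOn (μ.prod μ) hmean2 L' Finset.univ
  rw [← hmap, integral_map (hZ.prodMap hZ).aemeasurable
    (Continuous.aestronglyMeasurable (by fun_prop)), hmap] at h
  simp only [hL'a, Prod.map_fst, Prod.map_snd, ← apply_ite Z] at h
  rw [h, Finset.sum_filter]
  refine Finset.sum_congr rfl fun π hπ => ?_
  -- Centered functionals of different copies are uncorrelated, so a pairing with a chord between
  -- the copies has a zero factor.
  have hcross : ∀ k l, s k → ¬ s l → ∫ z : E × E, L k z.1 * L l z.2 ∂(μ.prod μ) = 0 := by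
    intro k l _ _
    rw [integral_prod_mul (fun z => L k z) (fun z => L l z), hzero, zero_mul]
  split_ifs with hs
  · refine Finset.prod_congr rfl fun k _ => ?_
    by_cases hk : s k
    · simp only [hk, (hs k).1 hk, if_true]
      simpa using integral_fun_fst (μ := μ) (ν := μ) (fun z => L k z * L (π k) z)
    · simp only [hk, mt (hs k).2 hk, if_false]
      simpa using integral_fun_snd (μ := μ) (ν := μ) (fun z => L k z * L (π k) z)
  · obtain ⟨h1, h2⟩ := mem_involutionsOn.1 hπ
    push Not at hs
    obtain ⟨k, hk⟩ : ∃ k, k < π k ∧ ¬ (s k ↔ s (π k)) := by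
      obtain ⟨k, hk⟩ := hs
      rcases ((h2 k).2 (Finset.mem_univ k)).lt_or_gt with hlt | hlt
      · exact ⟨π k, by rwa [h1], by rw [h1]; tauto⟩
      · exact ⟨k, hlt, by tauto⟩
    refine Finset.prod_eq_zero (i := k) (by simp [hk.1]) ?_
    by_cases hsk : s k
    · have : ¬ s (π k) := by tauto
      simp only [hsk, this, if_true, if_false]
      exact hcross _ _ hsk this
    · have : s (π k) := by tauto
      simp only [hsk, this, if_true, if_false]
      simp only [mul_comm (L k _)]
      exact hcross _ _ this hsk

end Wick

/-! ### Traces of matrix products as sums over closed index paths -/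

section Trace

variable {κ R : Type*} [Fintype κ] [DecidableEq κ] [CommSemiring R]

theorem Matrix.list_ofFn_prod_apply {m : ℕ} (M : Fin (m + 1) → Matrix κ κ R) (a b : κ) :
    (List.ofFn M).prod a b =
      ∑ i : Fin m → κ, ∏ t, M t (Fin.cons (α := fun _ => κ) a i t)
        (Fin.snoc (α := fun _ => κ) i b t) := by
  induction m generalizing a with
  | zero => simp [Fin.snoc]
  | succ m ih =>
    rw [List.ofFn_succ, List.prod_cons, Matrix.mul_apply,
      ← (Fin.consEquiv fun _ : Fin (m + 1) => κ).sum_comp, Fintype.sum_prod_type]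
    refine Finset.sum_congr rfl fun c _ => ?_
    rw [ih, Finset.mul_sum]
    refine Finset.sum_congr rfl fun i _ => ?_
    conv_rhs => rw [Fin.prod_univ_succ]
    simp only [Fin.consEquiv, Equiv.coe_fn_mk, Fin.cons_zero, Fin.cons_succ,
      ← Fin.cons_snoc_eq_snoc_cons]

theorem Matrix.trace_list_ofFn_prod {n : ℕ} (hn : 1 ≤ n) (M : Fin n → Matrix κ κ R) :
    (List.ofFn M).prod.trace = ∑ i : Fin n → κ, ∏ t, M t (i t) (i (finRotate n t)) := by
  obtain ⟨m, rfl⟩ : ∃ m, n = m + 1 := ⟨n - 1, by omega⟩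
  simp only [Matrix.trace, Matrix.diag, Matrix.list_ofFn_prod_apply]
  rw [← (Fin.consEquiv fun _ : Fin (m + 1) => κ).sum_comp, Fintype.sum_prod_type]
  refine Finset.sum_congr rfl fun c _ => Finset.sum_congr rfl fun i _ => ?_
  -- With equal endpoints the path closes up, and the column labels are the row labels rotated by
  -- one.
  simp only [Fin.consEquiv, Equiv.coe_fn_mk, Fin.snoc_eq_cons_rotate]

end Trace

/-! ### Joint Gaussianity and covariances of the entries -/

section Elliptic

variable {Ω : Type*} [MeasurableSpace Ω] {N : ℕ} {γ : ℝ} {P : Measure Ω}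
  {X : Ω → Matrix (Fin N) (Fin N) ℂ}

/-- The upper-triangular pairs `(A i j, A j i)`, `i ≤ j`, of a matrix. -/
def Matrix.upperPairs {N : ℕ} (A : Matrix (Fin N) (Fin N) ℂ)
    (e : {e : Fin N × Fin N // e.1 ≤ e.2}) : ℂ × ℂ :=
  (A e.1.1 e.1.2, A e.1.2 e.1.1)

/-- The entry `(i, j)` of a matrix as a linear functional of its upper-triangular pairs. -/
noncomputable def entryCLM {N : ℕ} (i j : Fin N) :
    ({e : Fin N × Fin N // e.1 ≤ e.2} → ℂ × ℂ) →L[ℝ] ℂ :=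
  if h : i ≤ j then
    (ContinuousLinearMap.fst ℝ ℂ ℂ).comp (ContinuousLinearMap.proj ⟨(i, j), h⟩)
  else
    (ContinuousLinearMap.snd ℝ ℂ ℂ).comp (ContinuousLinearMap.proj ⟨(j, i), (not_le.1 h).le⟩)

theorem entryCLM_upperPairs (A : Matrix (Fin N) (Fin N) ℂ) (i j : Fin N) :
    entryCLM i j A.upperPairs = A i j := by
  unfold entryCLM
  split_ifs <;> rfl

/-- The entry `(i, j)` of `A ^ c` as a linear functional of the upper-triangular pairs of `A`. -/
noncomputable def letterCLM {N : ℕ} (c : Letter) (i j : Fin N) :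
    ({e : Fin N × Fin N // e.1 ≤ e.2} → ℂ × ℂ) →L[ℝ] ℂ :=
  match c with
  | Letter.one => entryCLM i j
  | Letter.star => (Complex.conjCLE : ℂ →L[ℝ] ℂ).comp (entryCLM j i)

theorem letterCLM_upperPairs (A : Matrix (Fin N) (Fin N) ℂ) (c : Letter) (i j : Fin N) :
    letterCLM c i j A.upperPairs = A.letterPow c i j := by
  cases c
  · exact entryCLM_upperPairs A i j
  · simp [letterCLM, entryCLM_upperPairs, Matrix.letterPow]

namespace IsComplexElliptic

/-- Independent Gaussian blocks are jointly Gaussian. A diagonal block is the image of one entry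
under the diagonal map, so it is Gaussian though degenerate. -/
theorem hasGaussianLaw_upperPairs [IsProbabilityMeasure P] (hX : IsComplexElliptic γ P X) :
    HasGaussianLaw (fun ω => (X ω).upperPairs) P := by
  refine iIndepFun.hasGaussianLaw (fun e => ?_) hX.indep
  obtain ⟨⟨i, j⟩, hij : i ≤ j⟩ := e
  rcases hij.lt_or_eq with h | rfl
  · exact hX.gaussian_offDiag i j h
  · exact (hX.gaussian_diag i).map_fun
      ((ContinuousLinearMap.id ℝ ℂ).prod (ContinuousLinearMap.id ℝ ℂ))

theorem memLp_entry [IsProbabilityMeasure P] (hX : IsComplexElliptic γ P X) (i j : Fin N) :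
    MemLp (fun ω => X ω i j) 2 P := by
  have := (hX.hasGaussianLaw_upperPairs.map_fun (entryCLM i j)).memLp_two
  simpa only [entryCLM_upperPairs] using this

/-- Entries at positions that are neither equal nor transposed belong to different independent
blocks. -/
theorem indepFun_entry (hX : IsComplexElliptic γ P X) {i j k l : Fin N}
    (h1 : ¬(i = k ∧ j = l)) (h2 : ¬(i = l ∧ j = k)) :
    IndepFun (fun ω => X ω i j) (fun ω => X ω k l) P := by
  have key : ∀ i j : Fin N, ∃ (e : {e : Fin N × Fin N // e.1 ≤ e.2}) (φ : ℂ × ℂ → ℂ),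
      Measurable φ ∧ (e.1 = (i, j) ∨ e.1 = (j, i)) ∧
        (fun ω => X ω i j) = φ ∘ fun ω => ((X ω e.1.1 e.1.2, X ω e.1.2 e.1.1) : ℂ × ℂ) := by
    intro i j
    rcases le_total i j with h | h
    · exact ⟨⟨(i, j), h⟩, Prod.fst, measurable_fst, Or.inl rfl, rfl⟩
    · exact ⟨⟨(j, i), h⟩, Prod.snd, measurable_snd, Or.inr rfl, rfl⟩
  obtain ⟨e, φ, hφ, he, hφX⟩ := key i j
  obtain ⟨e', ψ, hψ, he', hψX⟩ := key k l
  rw [hφX, hψX]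
  refine (hX.indep.indepFun ?_).comp hφ hψ
  rintro rfl
  rcases he with he | he <;> rcases he' with he' | he' <;> rw [he] at he' <;>
    simp only [Prod.mk.injEq] at he' <;> tauto

theorem integral_entry_mul_entry (hX : IsComplexElliptic γ P X) (i j k l : Fin N) :
    ∫ ω, X ω i j * X ω k l ∂P = if i = l ∧ j = k then (γ : ℂ) else 0 := by
  split_ifs with h
  · obtain ⟨rfl, rfl⟩ := h
    rcases lt_trichotomy i j with h | rfl | h
    · exact hX.mul_offDiag i j h
    · simpa only [sq] using hX.sq_diag i
    · simpa only [mul_comm] using hX.mul_offDiag j i h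
  · by_cases h' : i = k ∧ j = l
    · obtain ⟨rfl, rfl⟩ := h'
      have hij : i ≠ j := fun hij => h ⟨hij, hij.symm⟩
      rcases hij.lt_or_gt with hij | hij
      · simpa only [sq] using (hX.sq_offDiag i j hij).1
      · simpa only [sq] using (hX.sq_offDiag j i hij).2
    · rw [(hX.indepFun_entry h' h).integral_fun_mul_eq_mul_integral
        (hX.measurable i j).aestronglyMeasurable (hX.measurable k l).aestronglyMeasurable,
        hX.centered, zero_mul]

theorem integral_entry_mul_conj_entry (hX : IsComplexElliptic γ P X) (i j k l : Fin N) :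
    ∫ ω, X ω i j * (starRingEnd ℂ) (X ω k l) ∂P = if i = k ∧ j = l then 1 else 0 := by
  split_ifs with h
  · obtain ⟨rfl, rfl⟩ := h
    have h1 : ∫ ω, ‖X ω i j‖ ^ 2 ∂P = 1 := by
      rcases lt_trichotomy i j with h | rfl | h
      · exact (hX.normSq_offDiag i j h).1
      · exact hX.normSq_diag i
      · exact (hX.normSq_offDiag j i h).2
    simp only [Complex.mul_conj']
    have := congrArg (fun x : ℝ => (x : ℂ)) h1
    simpa only [← integral_complex_ofReal, Complex.ofReal_pow, Complex.ofReal_one] using this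
  · by_cases h' : i = l ∧ j = k
    · obtain ⟨rfl, rfl⟩ := h'
      have hij : i ≠ j := fun hij => h ⟨hij, hij.symm⟩
      rcases hij.lt_or_gt with hij | hij
      · exact hX.mul_conj_offDiag i j hij
      · have h1 := congrArg (starRingEnd ℂ) (hX.mul_conj_offDiag j i hij)
        rw [← integral_conj] at h1
        simpa [mul_comm] using h1
    · refine ((hX.indepFun_entry h h').integral_fun_comp_mul_comp (f := fun z => z)
        (g := starRingEnd ℂ) (hX.measurable i j).aemeasurable (hX.measurable k l).aemeasurable
        continuous_id.aestronglyMeasurable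
        Complex.continuous_conj.aestronglyMeasurable).trans ?_
      rw [hX.centered, zero_mul]

/-- The transpose inside `Xᴴ` turns the constraint of E[X X̄] into that of E[X X], so the index
pattern is the same for all types. In the case of two stars, γ survives conjugation because it is
real. -/
theorem integral_letterPow_mul_letterPow (hX : IsComplexElliptic γ P X) (c d : Letter)
    (i j k l : Fin N) :
    ∫ ω, (X ω).letterPow c i j * (X ω).letterPow d k l ∂P =
      (if c = d then (γ : ℂ) else 1) * if i = l ∧ j = k then 1 else 0 := by
  cases c <;> cases d <;> simp only [Matrix.letterPow, Matrix.conjTranspose_apply]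
  · simpa using hX.integral_entry_mul_entry i j k l
  · simpa using hX.integral_entry_mul_conj_entry i j l k
  · have := hX.integral_entry_mul_conj_entry k l j i
    simpa [mul_comm, eq_comm, and_comm] using this
  · have := congrArg (starRingEnd ℂ) (hX.integral_entry_mul_entry j i l k)
    rw [← integral_conj] at this
    simpa [and_comm, apply_ite (starRingEnd ℂ)] using this

end IsComplexElliptic

end Elliptic

/-! ### The rotation of the two circles and the labellings constant on orbits -/

section AnnularRotation

/-- The successor permutation of the two circles, with cycles `(0 … p-1)` and `(p … p+q-1)`. -/
def annularRotation (p q : ℕ) : Equiv.Perm (Fin (p + q)) :=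
  finSumFinEquiv.permCongr (Equiv.sumCongr (finRotate p) (finRotate q))

theorem annularRotation_castAdd (p q : ℕ) (t : Fin p) :
    annularRotation p q (Fin.castAdd q t) = Fin.castAdd q (finRotate p t) := by
  simp [annularRotation, Equiv.permCongr_apply]

theorem annularRotation_natAdd (p q : ℕ) (t : Fin q) :
    annularRotation p q (Fin.natAdd p t) = Fin.natAdd p (finRotate q t) := by
  simp [annularRotation, Equiv.permCongr_apply]

/-- The functions that are constant along the orbits of a permutation. -/
def invariantFunctions {ι : Type*} (M : Type*) [Fintype ι] [DecidableEq ι] [Fintype M]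
    [DecidableEq M] (f : Equiv.Perm ι) : Finset (ι → M) :=
  Finset.univ.filter fun i => ∀ k, i (f k) = i k

theorem mem_invariantFunctions {ι M : Type*} [Fintype ι] [DecidableEq ι] [Fintype M]
    [DecidableEq M] {f : Equiv.Perm ι} {i : ι → M} :
    i ∈ invariantFunctions M f ↔ ∀ k, i (f k) = i k := by
  simp [invariantFunctions]

end AnnularRotation

/-! ### Expansion of the traces of words -/

section WordTrace

theorem traceWord_smul {N n : ℕ} (c : ℝ) (A : Matrix (Fin N) (Fin N) ℂ) (τ : Fin n → Letter) :
    traceWord ((c : ℂ) • A) τ = (c : ℂ) ^ n * traceWord A τ := by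
  have h : ∀ a, ((c : ℂ) • A).letterPow a = (c : ℂ) • A.letterPow a := by
    rintro (_ | _)
    · rfl
    · simp [Matrix.letterPow, Matrix.conjTranspose_smul]
  have : ∀ l : List (Matrix (Fin N) (Fin N) ℂ),
      (l.map ((c : ℂ) • ·)).prod = (c : ℂ) ^ l.length • l.prod := by
    intro l
    induction l with
    | nil => simp
    | cons a l ih =>
      rw [List.map_cons, List.prod_cons, ih, List.length_cons, List.prod_cons, smul_mul_smul_comm,
        pow_succ']
  unfold traceWord
  simp only [h]
  have h2 := this (List.ofFn fun t => A.letterPow (τ t))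
  rw [List.map_ofFn, List.length_ofFn] at h2
  rw [← smul_eq_mul, ← Matrix.trace_smul, ← h2]
  rfl

theorem traceWord_eq_sum {N n : ℕ} (hn : 1 ≤ n) (A : Matrix (Fin N) (Fin N) ℂ)
    (τ : Fin n → Letter) :
    traceWord A τ = ∑ i : Fin n → Fin N, ∏ t, A.letterPow (τ t) (i t) (i (finRotate n t)) :=
  Matrix.trace_list_ofFn_prod hn _

/-- Two matrices are allowed so that the same expansion serves E[W₁W₂], with `A = B`, and
E[W₁]E[W₂], with independent copies. -/
theorem traceWord_mul_traceWord {N p q : ℕ} (hp : 1 ≤ p) (hq : 1 ≤ q)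
    (A B : Matrix (Fin N) (Fin N) ℂ) (τ : Fin (p + q) → Letter) :
    traceWord A (fun t : Fin p => τ (Fin.castAdd q t)) *
      traceWord B (fun t : Fin q => τ (Fin.natAdd p t)) =
    ∑ i : Fin (p + q) → Fin N, ∏ k, (if k.val < p then A else B).letterPow (τ k) (i k)
      (i (annularRotation p q k)) := by
  rw [traceWord_eq_sum hp, traceWord_eq_sum hq, Finset.sum_mul_sum, ← Fintype.sum_prod_type',
    ← (Fin.appendEquiv (α := Fin N) p q).sum_comp]
  refine Finset.sum_congr rfl fun i _ => ?_
  rw [Fin.prod_univ_add]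
  simp [Fin.appendEquiv, annularRotation_castAdd, annularRotation_natAdd]

end WordTrace

/-! ### The covariance as a sum over pairings with a spoke -/

section Covariance

variable {Ω : Type*} [MeasurableSpace Ω] {N : ℕ} {γ : ℝ} {P : Measure Ω}
  {X : Ω → Matrix (Fin N) (Fin N) ℂ}

/-- The contribution of the labelling `i` to the pair partition `π` in the Wick formula. -/
theorem prod_covariance_eq {n : ℕ} {σ π : Equiv.Perm (Fin n)} (hπ : IsPairing π) (γ : ℂ)
    (τ : Fin n → Letter) (i : Fin n → Fin N) :
    ∏ k with k < π k, ((if τ k = τ (π k) then γ else 1) *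
        if i k = i (σ (π k)) ∧ i (σ k) = i (π k) then 1 else 0) =
      if i ∈ invariantFunctions (Fin N) (σ * π) then γ ^ sameTypePairs π τ else 0 := by
  rw [Finset.prod_mul_distrib]
  have h1 : ∏ k with k < π k, (if τ k = τ (π k) then γ else 1) = γ ^ sameTypePairs π τ := by
    rw [← Finset.prod_filter, Finset.filter_filter, Finset.prod_const]
    rfl
  rw [h1]
  have h2 : (∏ k with k < π k, if i k = i (σ (π k)) ∧ i (σ k) = i (π k) then (1 : ℂ) else 0) =
      if i ∈ invariantFunctions (Fin N) (σ * π) then 1 else 0 := by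
    rw [Finset.prod_ite_zero]
    simp only [Finset.prod_const_one]
    refine if_congr ?_ rfl rfl
    rw [mem_invariantFunctions]
    simp only [Finset.mem_filter, Finset.mem_univ, true_and, Equiv.Perm.mul_apply]
    -- The two constraints of a chord {k, π k} are the invariance of `i` under `σ * π` at `k` and at
    -- `π k`.
    constructor
    · intro h k
      rcases (hπ k).1.lt_or_gt with hk | hk
      · have := (h (π k) (by rw [(hπ k).2]; exact hk)).2
        rwa [(hπ k).2] at this
      · exact (h k hk).1.symm
    · intro h k _
      refine ⟨(h k).symm, ?_⟩
      have := h (π k)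
      rwa [(hπ k).2] at this
  rw [h2]
  split_ifs <;> simp

theorem mem_involutionsOn_univ {n : ℕ} {π : Equiv.Perm (Fin n)} :
    π ∈ involutionsOn Finset.univ ↔ IsPairing π := by
  simp only [mem_involutionsOn, Finset.mem_univ, iff_true, IsPairing]
  exact ⟨fun h x => ⟨h.2 x, h.1 x⟩, fun h => ⟨fun x => (h x).2, fun x => (h x).1⟩⟩

namespace IsComplexElliptic

theorem memLp_traceWord [IsProbabilityMeasure P] (hX : IsComplexElliptic γ P X) {n : ℕ}
    (hn : 1 ≤ n) (τ : Fin n → Letter) (r : ENNReal) (hr : r ≠ ⊤) :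
    MemLp (fun ω => traceWord (X ω) τ) r P := by
  have hG := hX.hasGaussianLaw_upperPairs
  have := hG.isGaussian_map
  simp only [traceWord_eq_sum hn]
  refine memLp_finsetSum _ fun i _ => ?_
  have h := memLp_prod_clm (P.map fun ω => (X ω).upperPairs) Finset.univ
    (fun t : Fin n => letterCLM (τ t) (i t) (i (finRotate n t))) r hr
  have h2 := (memLp_map_measure_iff h.1 hG.aemeasurable).1 h
  simpa only [Function.comp_def, letterCLM_upperPairs] using h2

theorem integral_upperPairs [IsProbabilityMeasure P] (hX : IsComplexElliptic γ P X) :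
    ∫ z, z ∂(P.map fun ω => (X ω).upperPairs) = 0 := by
  have hG := hX.hasGaussianLaw_upperPairs
  rw [integral_map hG.aemeasurable (by fun_prop)]
  have hi : ∀ i j, Integrable (fun ω => X ω i j) P := fun i j =>
    (hX.memLp_entry i j).integrable (by norm_num)
  funext e
  have h := eval_integral (μ := P) (f := fun ω e => (X ω).upperPairs e)
    (fun e => (hi e.1.1 e.1.2).prodMk (hi e.1.2 e.1.1)) e
  refine h.trans ?_
  simp only [Matrix.upperPairs]
  rw [integral_pair (hi _ _) (hi _ _), hX.centered, hX.centered]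
  rfl

theorem integral_letterCLM_mul_letterCLM [IsProbabilityMeasure P]
    (hX : IsComplexElliptic γ P X) (c d : Letter) (i j k l : Fin N) :
    ∫ z, letterCLM c i j z * letterCLM d k l z ∂(P.map fun ω => (X ω).upperPairs) =
      (if c = d then (γ : ℂ) else 1) * if i = l ∧ j = k then 1 else 0 := by
  rw [integral_map hX.hasGaussianLaw_upperPairs.aemeasurable
    (Continuous.aestronglyMeasurable (by fun_prop))]
  simp only [letterCLM_upperPairs]
  exact hX.integral_letterPow_mul_letterPow c d i j k l

theorem integrable_prod_letterPow [IsProbabilityMeasure P] (hX : IsComplexElliptic γ P X)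
    {n : ℕ} (τ : Fin n → Letter) (i j : Fin n → Fin N) :
    Integrable (fun ω => ∏ k, (X ω).letterPow (τ k) (i k) (j k)) P := by
  have hG := hX.hasGaussianLaw_upperPairs
  have := hG.isGaussian_map
  have h := (integrable_prod_clm (P.map fun ω => (X ω).upperPairs) Finset.univ
    (fun k => letterCLM (τ k) (i k) (j k))).comp_aemeasurable hG.aemeasurable
  simpa only [Function.comp_def, letterCLM_upperPairs] using h

theorem integral_prod_letterPow [IsProbabilityMeasure P] (hX : IsComplexElliptic γ P X) {n : ℕ}
    (σ : Equiv.Perm (Fin n)) (τ : Fin n → Letter) (i : Fin n → Fin N) :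
    ∫ ω, ∏ k, (X ω).letterPow (τ k) (i k) (i (σ k)) ∂P =
      ∑ π with IsPairing π,
        if i ∈ invariantFunctions (Fin N) (σ * π) then (γ : ℂ) ^ sameTypePairs π τ else 0 := by
  have hG := hX.hasGaussianLaw_upperPairs
  have := hG.isGaussian_map
  have h := integral_prod_clm_eq_sum_involutionsOn (P.map fun ω => (X ω).upperPairs)
    hX.integral_upperPairs (fun k => letterCLM (τ k) (i k) (i (σ k))) Finset.univ
  rw [integral_map hG.aemeasurable (Continuous.aestronglyMeasurable (by fun_prop))] at h
  simp only [letterCLM_upperPairs] at h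
  rw [h]
  refine Finset.sum_congr (by ext; simp [mem_involutionsOn_univ]) fun π hπ => ?_
  rw [← prod_covariance_eq (Finset.mem_filter.1 hπ).2]
  exact Finset.prod_congr rfl fun k _ => hX.integral_letterCLM_mul_letterCLM _ _ _ _ _ _

theorem integral_prod_letterPow_prod [IsProbabilityMeasure P] (hX : IsComplexElliptic γ P X)
    {p q : ℕ} (σ : Equiv.Perm (Fin (p + q))) (τ : Fin (p + q) → Letter)
    (i : Fin (p + q) → Fin N) :
    ∫ w : Ω × Ω, ∏ k, (if k.val < p then X w.1 else X w.2).letterPow (τ k) (i k) (i (σ k))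
        ∂(P.prod P) =
      ∑ π with IsPairing π ∧ ¬ ∃ x y, IsSpoke p q π x y,
        if i ∈ invariantFunctions (Fin N) (σ * π) then (γ : ℂ) ^ sameTypePairs π τ else 0 := by
  have hmeas : Measurable fun ω => (X ω).upperPairs :=
    measurable_pi_iff.2 fun e => (hX.measurable _ _).prodMk (hX.measurable _ _)
  have h := integral_prod_clm_prod_eq_sum_involutionsOn P hmeas hX.hasGaussianLaw_upperPairs
    hX.integral_upperPairs (fun k => letterCLM (τ k) (i k) (i (σ k))) (fun k => k.val < p)
  simp only [letterCLM_upperPairs, apply_ite X] at h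
  rw [h]
  refine Finset.sum_congr ?_ fun π hπ => ?_
  · ext π
    simp only [Finset.mem_filter, mem_involutionsOn_univ, Finset.mem_univ, true_and]
    refine and_congr_right fun hπ => ?_
    simp only [IsSpoke]
    constructor
    · rintro h ⟨x, y, hx, hy, rfl⟩
      exact absurd ((h x).1 hx) (not_lt.2 hy)
    · intro h k
      constructor
      · intro hk
        by_contra hk'
        exact h ⟨k, π k, hk, not_lt.1 hk', rfl⟩
      · intro hk
        by_contra hk'
        exact h ⟨π k, k, hk, not_lt.1 hk', (hπ k).2⟩
  · rw [← prod_covariance_eq (Finset.mem_filter.1 hπ).2.1]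
    exact Finset.prod_congr rfl fun k _ => hX.integral_letterCLM_mul_letterCLM _ _ _ _ _ _

/-- The product of means is an integral over `P.prod P`, and its Wick expansion consists of the
spokeless pairings. Subtracting them is exact for every `N`. -/
theorem kappa₂_traceWord [IsProbabilityMeasure P] (hX : IsComplexElliptic γ P X) {p q : ℕ}
    (hp : 1 ≤ p) (hq : 1 ≤ q) (τ : Fin (p + q) → Letter) :
    kappa₂ P (fun ω => traceWord (X ω) fun t : Fin p => τ (Fin.castAdd q t))
        (fun ω => traceWord (X ω) fun t : Fin q => τ (Fin.natAdd p t)) =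
      ∑ π with IsPairing π ∧ ∃ x y, IsSpoke p q π x y, (γ : ℂ) ^ sameTypePairs π τ *
        (invariantFunctions (Fin N) (annularRotation p q * π)).card := by
  have e1 : ∫ ω, traceWord (X ω) (fun t : Fin p => τ (Fin.castAdd q t)) *
      traceWord (X ω) (fun t : Fin q => τ (Fin.natAdd p t)) ∂P =
      ∑ i : Fin (p + q) → Fin N, ∑ π with IsPairing π,
        if i ∈ invariantFunctions (Fin N) (annularRotation p q * π)
          then (γ : ℂ) ^ sameTypePairs π τ else 0 := by
    simp only [traceWord_mul_traceWord hp hq, ite_self]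
    rw [integral_finsetSum]
    · exact Finset.sum_congr rfl fun i _ => hX.integral_prod_letterPow _ τ i
    · intro i _
      exact hX.integrable_prod_letterPow τ i _
  have e2 : (∫ ω, traceWord (X ω) (fun t : Fin p => τ (Fin.castAdd q t)) ∂P) *
      ∫ ω, traceWord (X ω) (fun t : Fin q => τ (Fin.natAdd p t)) ∂P =
      ∑ i : Fin (p + q) → Fin N, ∑ π with IsPairing π ∧ ¬ ∃ x y, IsSpoke p q π x y,
        if i ∈ invariantFunctions (Fin N) (annularRotation p q * π)
          then (γ : ℂ) ^ sameTypePairs π τ else 0 := by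
    rw [← integral_prod_mul]
    simp only [traceWord_mul_traceWord hp hq]
    rw [integral_finsetSum]
    · exact Finset.sum_congr rfl fun i _ => hX.integral_prod_letterPow_prod _ τ i
    · intro i _
      simp only [Fin.prod_univ_add, Fin.val_castAdd, Fin.is_lt, if_true, Fin.val_natAdd,
        not_lt.2 (Nat.le_add_right p _), if_false]
      exact (hX.integrable_prod_letterPow _ _ _).mul_prod (hX.integrable_prod_letterPow _ _ _)
  rw [kappa₂, e1, e2, ← Finset.sum_sub_distrib]
  have : ∀ i : Fin (p + q) → Fin N, (∑ π with IsPairing π,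
        if i ∈ invariantFunctions (Fin N) (annularRotation p q * π)
          then (γ : ℂ) ^ sameTypePairs π τ else 0) -
      (∑ π with IsPairing π ∧ ¬ ∃ x y, IsSpoke p q π x y,
        if i ∈ invariantFunctions (Fin N) (annularRotation p q * π)
          then (γ : ℂ) ^ sameTypePairs π τ else 0) =
      ∑ π with IsPairing π ∧ ∃ x y, IsSpoke p q π x y,
        if i ∈ invariantFunctions (Fin N) (annularRotation p q * π)
          then (γ : ℂ) ^ sameTypePairs π τ else 0 := by
    intro i
    rw [sub_eq_iff_eq_add, ← Finset.filter_filter, ← Finset.filter_filter,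
      Finset.sum_filter_add_sum_filter_not]
  simp only [this]
  rw [Finset.sum_comm]
  refine Finset.sum_congr rfl fun π _ => ?_
  rw [← Finset.sum_filter, Finset.sum_const, nsmul_eq_mul, mul_comm]
  congr 3
  ext i
  simp

end IsComplexElliptic

end Covariance

/-! ### How a transposition changes the number of invariant labellings -/

section InvariantFunctions

open Equiv

/-- The inverse of `f` is a power of `f`, so forward stability of a set already gives invariance. -/
theorem Equiv.Perm.apply_iff_of_forall_imp {ι : Type*} [Fintype ι] {f : Perm ι} {S : ι → Prop}
    (hS : ∀ k, S k → S (f k)) (k : ι) : S (f k) ↔ S k := by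
  refine ⟨fun h => ?_, hS k⟩
  have hpow : ∀ n : ℕ, S ((f ^ n) (f k)) := by
    intro n
    induction n with
    | zero => exact h
    | succ n ih => rw [pow_succ', Perm.mul_apply]; exact hS _ ih
  have h1 := hpow (orderOf f - 1)
  rwa [← Perm.mul_apply, ← pow_succ, Nat.sub_add_cancel (orderOf_pos f), pow_orderOf_eq_one] at h1

theorem card_erase_erase {ι : Type*} [DecidableEq ι] {T : Finset ι} {a b : ι} (ha : a ∈ T)
    (hb : b ∈ T) (hab : a ≠ b) :
    ((T.erase a).erase b).card + 2 = T.card := by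
  have h1 := Finset.card_erase_add_one ha
  have h2 := Finset.card_erase_add_one (Finset.mem_erase.2 ⟨hab.symm, hb⟩)
  omega

variable {ι : Type*} [Fintype ι] [DecidableEq ι] {M : Type*} [Fintype M] [DecidableEq M]

theorem mem_invariantFunctions_swap_mul {f : Perm ι} {a b : ι} {i : ι → M}
    (hi : i ∈ invariantFunctions M f) (hab : i a = i b) :
    i ∈ invariantFunctions M (swap a b * f) := by
  rw [mem_invariantFunctions] at hi ⊢
  intro k
  rw [Perm.mul_apply, ← hi k, swap_apply_def]
  split_ifs with h1 h2
  · rw [h1, hab]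
  · rw [h2, hab]
  · rfl

/-- A labelling that takes the same value at `a` and `b` does not see the transposition. -/
theorem filter_invariantFunctions_swap_mul (f : Perm ι) (a b : ι) :
    (invariantFunctions M (swap a b * f)).filter (fun i => i a = i b) =
      (invariantFunctions M f).filter (fun i => i a = i b) := by
  ext i
  simp only [Finset.mem_filter]
  refine and_congr_left fun hab => ⟨fun h => ?_, fun h => mem_invariantFunctions_swap_mul h hab⟩
  simpa [← mul_assoc] using mem_invariantFunctions_swap_mul h hab

/-- The two products are conjugate; composition with `f` carries the labellings of one to those of
the other. -/
theorem card_invariantFunctions_mul_comm (f g : Perm ι) :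
    (invariantFunctions M (f * g)).card = (invariantFunctions M (g * f)).card := by
  have h : ∀ f g : Perm ι,
      (invariantFunctions M (f * g)).card ≤ (invariantFunctions M (g * f)).card := by
    intro f g
    refine Finset.card_le_card_of_injOn (fun i => i ∘ f) ?_ ?_
    · intro i hi
      rw [Finset.mem_coe, mem_invariantFunctions] at hi ⊢
      exact fun k => hi (f k)
    · intro i _ j _ hij
      exact f.surjective.injective_comp_right hij
  exact le_antisymm (h f g) (h g f)

variable [AddCommGroup M]

/-- Group the labellings by the difference `i a - i b`: subtracting a fixed member embeds each group
into the one with difference zero. -/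
theorem card_invariantFunctions_le_mul_filter (f : Perm ι) (a b : ι) :
    (invariantFunctions M f).card ≤
      ((invariantFunctions M f).filter fun i => i a = i b).card * Fintype.card M := by
  refine Finset.card_le_mul_card_image_of_maps_to (f := fun i : ι → M => i a - i b)
    (t := Finset.univ) (fun _ _ => Finset.mem_univ _) _ fun c _ => ?_
  rcases ((invariantFunctions M f).filter fun i => i a - i b = c).eq_empty_or_nonempty with h | h
  · simp [h]
  obtain ⟨i₀, hi₀⟩ := h
  refine Finset.card_le_card_of_injOn (fun i => i - i₀) ?_ ?_
  · intro i hi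
    simp only [Finset.mem_coe, Finset.mem_filter, mem_invariantFunctions, Pi.sub_apply] at hi hi₀ ⊢
    refine ⟨fun k => by rw [hi.1, hi₀.1], ?_⟩
    rw [sub_eq_sub_iff_sub_eq_sub, hi.2, hi₀.2]
  · intro i _ j _ hij
    simpa using hij

/-- Adding a constant on the stable set `S` preserves invariance. As `S` separates `a` from `b`, the
constant can be recovered from the result. -/
theorem filter_mul_le_card_invariantFunctions {f : Perm ι} {a b : ι} {S : ι → Prop}
    (hS : ∀ k, S k → S (f k)) (ha : S a) (hb : ¬ S b) :
    ((invariantFunctions M f).filter fun i => i a = i b).card * Fintype.card M ≤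
      (invariantFunctions M f).card := by
  classical
  rw [← Finset.card_univ, ← Finset.card_product]
  refine Finset.card_le_card_of_injOn
    (fun w : (ι → M) × M => fun k => w.1 k + if S k then w.2 else 0) ?_ ?_
  · rintro ⟨i, c⟩ hi
    simp only [Finset.mem_coe, Finset.mem_product, Finset.mem_filter, mem_invariantFunctions]
      at hi ⊢
    intro k
    rw [hi.1.1, if_congr (Perm.apply_iff_of_forall_imp hS k) rfl rfl]
  · rintro ⟨i, c⟩ hi ⟨j, d⟩ hj hij
    simp only [Finset.mem_coe, Finset.mem_product, Finset.mem_filter] at hi hj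
    have h1 := congrFun hij a
    have h2 := congrFun hij b
    simp only [ha, hb, if_true, if_false, add_zero] at h1 h2
    rw [hi.1.2, hj.1.2, h2] at h1
    have hcd : c = d := add_left_cancel h1
    subst hcd
    refine Prod.ext ?_ rfl
    funext k
    exact add_right_cancel (congrFun hij k)

theorem card_invariantFunctions_swap_mul_le (f : Perm ι) (a b : ι) :
    (invariantFunctions M (swap a b * f)).card ≤
      (invariantFunctions M f).card * Fintype.card M := by
  refine (card_invariantFunctions_le_mul_filter _ a b).trans ?_
  rw [filter_invariantFunctions_swap_mul]
  exact Nat.mul_le_mul_right _ (Finset.card_filter_le _ _)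

/-- Multiplying by a transposition that joins two orbits does not create invariant functions. -/
theorem card_invariantFunctions_swap_mul_le_of_separated {f : Perm ι} {a b : ι} {S : ι → Prop}
    (hS : ∀ k, S k → S (f k)) (ha : S a) (hb : ¬ S b) :
    (invariantFunctions M (swap a b * f)).card ≤ (invariantFunctions M f).card := by
  refine (card_invariantFunctions_le_mul_filter _ a b).trans ?_
  rw [filter_invariantFunctions_swap_mul]
  exact filter_mul_le_card_invariantFunctions hS ha hb

/-- Multiplying by a transposition that splits an orbit. -/
theorem card_invariantFunctions_swap_mul_eq {f : Perm ι} {a b : ι} {S : ι → Prop}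
    (hf : ∀ i ∈ invariantFunctions M f, i a = i b)
    (hS : ∀ k, S k → S ((swap a b * f) k)) (ha : S a) (hb : ¬ S b) :
    (invariantFunctions M (swap a b * f)).card =
      (invariantFunctions M f).card * Fintype.card M := by
  refine le_antisymm (card_invariantFunctions_swap_mul_le f a b) ?_
  refine le_trans ?_ (filter_mul_le_card_invariantFunctions (M := M) hS ha hb)
  rw [filter_invariantFunctions_swap_mul, Finset.filter_true_of_mem hf]

theorem involutionsOn_apply_mem {T : Finset ι} {α : Perm ι} (hα : α ∈ involutionsOn T) {a : ι}
    (ha : a ∈ T) : α a ∈ T ∧ α a ≠ a := by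
  obtain ⟨h1, h2⟩ := mem_involutionsOn.1 hα
  have h3 := (h2 a).2 ha
  exact ⟨(h2 _).1 (by rw [h1]; exact h3.symm), h3⟩

theorem even_card_of_mem_involutionsOn {T : Finset ι} {α : Perm ι} (hα : α ∈ involutionsOn T) :
    Even T.card := by
  induction T using Finset.strongInduction generalizing α with
  | H T ih =>
    rcases T.eq_empty_or_nonempty with rfl | ⟨a, ha⟩
    · simp
    obtain ⟨hb, hab⟩ := involutionsOn_apply_mem hα ha
    have h1 := ih _ ((Finset.erase_subset _ _).trans_ssubset (Finset.erase_ssubset ha))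
      (mul_swap_mem_involutionsOn_erase hα a)
    rw [← card_erase_erase ha hb hab.symm]
    exact h1.add (by decide)

/-- Each of the |T|/2 chords is a transposition, and each costs at most one factor |M|. -/
theorem card_invariantFunctions_involution_mul_le {T : Finset ι} {α : Perm ι}
    (hα : α ∈ involutionsOn T) (f : Perm ι) :
    (invariantFunctions M (α * f)).card ≤
      (invariantFunctions M f).card * Fintype.card M ^ (T.card / 2) := by
  induction T using Finset.strongInduction generalizing α f with
  | H T ih =>
    rcases T.eq_empty_or_nonempty with rfl | ⟨a, ha⟩
    · rw [involutionsOn_empty, Finset.mem_singleton] at hα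
      simp [hα]
    obtain ⟨hb, hab⟩ := involutionsOn_apply_mem hα ha
    have h1 := ih _ ((Finset.erase_subset _ _).trans_ssubset (Finset.erase_ssubset ha))
      (mul_swap_mem_involutionsOn_erase hα a) (swap a (α a) * f)
    rw [← mul_assoc, mul_assoc α, swap_mul_self, mul_one] at h1
    have h2 := card_erase_erase ha hb hab.symm
    rw [← h2, Nat.add_div_right _ (by norm_num), pow_succ']
    refine h1.trans ?_
    rw [← mul_assoc]
    exact Nat.mul_le_mul_right _ (card_invariantFunctions_swap_mul_le f a (α a))

end InvariantFunctions

/-! ### Crossing and non-crossing chords on a single cycle -/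

section CyclicOrder

open Equiv

variable {ι : Type*} [Fintype ι] [DecidableEq ι] {M : Type*} [Fintype M] [DecidableEq M]

/-- `pos` enumerates the points from `0` on in the order of the cycle `ρ`. -/
structure IsCyclicEnumeration (pos : ι → ℕ) (ρ : Perm ι) : Prop where
  injective : Function.Injective pos
  pos_apply : ∀ z w, pos z < pos w → pos (ρ z) = pos z + 1
  exists_pred : ∀ z, 0 < pos z → ∃ w, pos w + 1 = pos z

/-- `α` has two chords `{a, α a}`, `{b, α b}` that cross in the order given by `pos`. -/
def HasCrossing (pos : ι → ℕ) (α : Perm ι) : Prop :=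
  ∃ a b, pos a < pos b ∧ pos b < pos (α a) ∧ pos (α a) < pos (α b)

variable {pos : ι → ℕ} {ρ : Perm ι}

theorem IsCyclicEnumeration.card_invariantFunctions [Nonempty ι]
    (h : IsCyclicEnumeration pos ρ) :
    (invariantFunctions M ρ).card = Fintype.card M := by
  have hconst : ∀ i ∈ invariantFunctions M ρ, ∀ n x y, pos x = n → pos y = 0 → i x = i y := by
    intro i hi n
    induction n with
    | zero => intro x y hx hy; rw [h.injective (hx.trans hy.symm)]
    | succ n ih =>
      intro x y hx hy
      obtain ⟨w, hw⟩ := h.exists_pred x (by omega)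
      have h1 : ρ w = x := h.injective (by rw [h.pos_apply w x (by omega), hw])
      rw [← h1, mem_invariantFunctions.1 hi w]
      exact ih w y (by omega) hy
  obtain ⟨x₀, hx₀⟩ : ∃ x₀, pos x₀ = 0 := by
    have : ∀ n x, pos x = n → ∃ x₀, pos x₀ = 0 := by
      intro n
      induction n with
      | zero => exact fun x hx => ⟨x, hx⟩
      | succ n ih =>
        intro x hx
        obtain ⟨w, hw⟩ := h.exists_pred x (by omega)
        exact ih w (by omega)
    exact this _ (Classical.arbitrary ι) rfl
  rw [← Finset.card_univ]
  refine Finset.card_nbij' (fun i => i x₀) (fun c _ => c) (by simp) ?_ ?_ (fun _ _ => rfl)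
  · intro c _
    simp [mem_invariantFunctions]
  · intro i hi
    funext k
    exact (hconst i hi _ k x₀ rfl hx₀).symm

variable [AddCommGroup M]

theorem IsCyclicEnumeration.card_invariantFunctions_involution_mul_le [Nonempty ι]
    (h : IsCyclicEnumeration pos ρ) {T : Finset ι} {α : Perm ι} (hα : α ∈ involutionsOn T)
    (hc : HasCrossing pos α) :
    (invariantFunctions M (α * ρ)).card ≤ Fintype.card M ^ (T.card / 2) := by
  obtain ⟨a, b, hab, hba, hab'⟩ := hc
  obtain ⟨h1, h2⟩ := mem_involutionsOn.1 hα
  have haT : a ∈ T := (h2 a).1 fun h => by rw [h] at hba; omega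
  have hbT : b ∈ T := (h2 b).1 fun h => by rw [h] at hab'; omega
  obtain ⟨ha'T, ha'⟩ := involutionsOn_apply_mem hα haT
  have hba1 : b ≠ a := by rintro rfl; omega
  have hba2 : b ≠ α a := by intro h; rw [← h] at hba; omega
  have hα₁ := mul_swap_mem_involutionsOn_erase hα a
  set α₁ := α * swap a (α a) with hα₁d
  have hα₁b : α₁ b = α b := by
    rw [hα₁d, Perm.mul_apply, swap_apply_of_ne_of_ne hba1 hba2]
  have hbT' : b ∈ (T.erase a).erase (α a) := by simp [hba1, hba2, hbT]
  obtain ⟨hb'T, hb'⟩ := involutionsOn_apply_mem hα₁ hbT'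
  have hα₂ := mul_swap_mem_involutionsOn_erase hα₁ b
  have hle := _root_.card_invariantFunctions_involution_mul_le (M := M) hα₂
    (swap b (α₁ b) * (swap a (α a) * ρ))
  have hmul : α₁ * swap b (α₁ b) * (swap b (α₁ b) * (swap a (α a) * ρ)) = α * ρ := by
    rw [hα₁d]
    simp [mul_assoc]
  rw [hmul] at hle
  -- The first chord closes the arc from `a` up to, but not including, `α a` into a stable set. A
  -- crossing chord joins this arc to its complement and so gains no factor.
  have hsep := card_invariantFunctions_swap_mul_le_of_separated (M := M)
    (f := swap a (α a) * ρ) (a := b) (b := α₁ b) (S := fun z => pos a ≤ pos z ∧ pos z < pos (α a))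
    (by
      rintro k ⟨hk1, hk2⟩
      have hk := h.pos_apply k (α a) hk2
      rw [Perm.mul_apply]
      by_cases hk3 : ρ k = α a
      · rw [hk3, swap_apply_right]
        exact ⟨le_rfl, by omega⟩
      · have : pos (ρ k) ≠ pos (α a) := fun h' => hk3 (h.injective h')
        rw [swap_apply_of_ne_of_ne (by intro h'; rw [h'] at hk; omega) hk3]
        omega)
    ⟨hab.le, hba⟩ (by rw [hα₁b]; omega)
  have h3 := card_invariantFunctions_swap_mul_le (M := M) ρ a (α a)
  rw [h.card_invariantFunctions] at h3
  have e1 := card_erase_erase haT ha'T ha'.symm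
  have e2 := card_erase_erase hbT' hb'T hb'.symm
  -- The cycle and the two crossing chords together give at most |M|², and every other chord at most
  -- |M|: one factor below the non-crossing value.
  have e3 : T.card / 2 = 2 + ((((T.erase a).erase (α a)).erase b).erase (α₁ b)).card / 2 := by
    omega
  rw [e3, pow_add, sq]
  exact hle.trans (Nat.mul_le_mul_right _ (hsep.trans h3))

/-- Induction on the number of chords: adding a chord that crosses none of the others splits one
orbit into two, and the bare cycle contributes the extra 1 in the exponent. -/
theorem IsCyclicEnumeration.card_invariantFunctions_involution_mul_eq [Nonempty ι]
    (h : IsCyclicEnumeration pos ρ) {T : Finset ι} {α : Perm ι} (hα : α ∈ involutionsOn T)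
    (hc : ¬ HasCrossing pos α) :
    (invariantFunctions M (α * ρ)).card = Fintype.card M ^ (T.card / 2 + 1) := by
  induction T using Finset.strongInduction generalizing α with
  | H T ih =>
    rcases T.eq_empty_or_nonempty with rfl | ⟨c, hc'⟩
    · rw [involutionsOn_empty, Finset.mem_singleton] at hα
      simp [hα, h.card_invariantFunctions]
    obtain ⟨h1, h2⟩ := mem_involutionsOn.1 hα
    obtain ⟨b, hb, hbb⟩ : ∃ b ∈ T, pos b < pos (α b) := by
      obtain ⟨h3, h4⟩ := involutionsOn_apply_mem hα hc'
      rcases lt_trichotomy (pos c) (pos (α c)) with h5 | h5 | h5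
      · exact ⟨c, hc', h5⟩
      · exact absurd (h.injective h5).symm h4
      · exact ⟨α c, h3, by rwa [h1]⟩
    obtain ⟨hb', hne⟩ := involutionsOn_apply_mem hα hb
    have hα' := mul_swap_mem_involutionsOn_erase hα b
    set b' := α b with hb'd
    set α' := α * swap b b' with hα'd
    have hαb' : α b' = b := h1 b
    have happ : ∀ z, z ≠ b → z ≠ b' → α' z = α z := by
      intro z hz1 hz2
      rw [hα'd, Perm.mul_apply, swap_apply_of_ne_of_ne hz1 hz2]
    have hα'b : α' b = b := by rw [hα'd, Perm.mul_apply, swap_apply_left, hαb']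
    have hα'b' : α' b' = b' := by rw [hα'd, Perm.mul_apply, swap_apply_right]
    -- Non-crossing: no chord leaves the open arc between `b` and `b'`.
    have harc : ∀ z, pos b < pos z → pos z < pos b' → pos b < pos (α' z) ∧ pos (α' z) < pos b' := by
      intro z hz1 hz2
      have hzb : z ≠ b := by rintro rfl; omega
      have hzb' : z ≠ b' := by rintro rfl; omega
      rw [happ z hzb hzb']
      have hn1 : pos (α z) ≠ pos b := fun h' => hzb' (by rw [← h1 z, h.injective h'])
      have hn2 : pos (α z) ≠ pos b' := fun h' => hzb (α.injective (h.injective h'))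
      by_contra hcon
      rcases lt_or_gt_of_ne hn1 with h3 | h3
      · exact hc ⟨α z, b, h3, by rwa [h1], by rwa [h1]⟩
      · exact hc ⟨b, z, hz1, hz2, lt_of_le_of_ne (not_lt.1 fun h' => hcon ⟨h3, h'⟩) hn2.symm⟩
    have hstep : ∀ z, pos b ≤ pos z → pos z < pos b' → ρ z = b' ∨
        (pos b < pos (α' (ρ z)) ∧ pos (α' (ρ z)) < pos b') := by
      intro z hz1 hz2
      have hz3 := h.pos_apply z b' hz2
      by_cases hz4 : ρ z = b'
      · exact Or.inl hz4
      · have : pos (ρ z) ≠ pos b' := fun h' => hz4 (h.injective h')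
        exact Or.inr (harc _ (by omega) (by omega))
    have hnc : ¬ HasCrossing pos α' := by
      rintro ⟨x, y, hxy, hyx, hxy'⟩
      have hxb : x ≠ b := by rintro rfl; rw [hα'b] at hyx; omega
      have hxb' : x ≠ b' := by rintro rfl; rw [hα'b'] at hyx; omega
      have hyb : y ≠ b := by rintro rfl; rw [hα'b] at hxy'; omega
      have hyb' : y ≠ b' := by rintro rfl; rw [hα'b'] at hxy'; omega
      rw [happ x hxb hxb'] at hyx hxy'
      rw [happ y hyb hyb'] at hxy'
      exact hc ⟨x, y, hxy, hyx, hxy'⟩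
    have hmul : α = swap b b' * α' := by
      ext z
      rw [Perm.mul_apply]
      rcases eq_or_ne z b with rfl | hz1
      · rw [hα'b, swap_apply_left]
      rcases eq_or_ne z b' with rfl | hz2
      · rw [hα'b', swap_apply_right, hαb']
      rw [happ z hz1 hz2, swap_apply_of_ne_of_ne]
      · intro h'; exact hz2 (by rw [← h1 z, h'])
      · intro h'; exact hz1 (α.injective h')
    have hih := ih _ ((Finset.erase_subset _ _).trans_ssubset (Finset.erase_ssubset hb)) hα' hnc
    rw [hmul, mul_assoc, card_invariantFunctions_swap_mul_eq
      (S := fun z => pos b ≤ pos z ∧ pos z < pos b') ?_ ?_ ⟨le_rfl, hbb⟩ (by simp), hih, ← pow_succ,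
      ← card_erase_erase hb hb' hne.symm, Nat.add_div_right _ (by norm_num)]
    -- The orbit of `b` under `α' * ρ` must reach `b'`: otherwise it would stay strictly inside the
    -- arc for ever and never return to `b`, against finite order.
    · intro i hi
      rw [mem_invariantFunctions] at hi
      by_contra hib
      have hpow : ∀ n : ℕ, i (((α' * ρ) ^ n) b) = i b := by
        intro n
        induction n with
        | zero => rfl
        | succ n ihn => rw [pow_succ', Perm.mul_apply, hi, ihn]
      have hwalk : ∀ n : ℕ, pos b ≤ pos (((α' * ρ) ^ n) b) → pos (((α' * ρ) ^ n) b) < pos b' →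
          pos b < pos (((α' * ρ) ^ (n + 1)) b) ∧ pos (((α' * ρ) ^ (n + 1)) b) < pos b' := by
        intro n hn1 hn2
        have hp := hpow (n + 1)
        rw [pow_succ', Perm.mul_apply, Perm.mul_apply α'] at hp ⊢
        rcases hstep _ hn1 hn2 with h3 | h3
        · rw [h3, hα'b'] at hp
          exact absurd hp.symm hib
        · exact h3
      have hall : ∀ n : ℕ, pos b < pos (((α' * ρ) ^ (n + 1)) b) ∧
          pos (((α' * ρ) ^ (n + 1)) b) < pos b' := by
        intro n
        induction n with
        | zero => exact hwalk 0 le_rfl hbb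
        | succ n ihn => exact hwalk (n + 1) ihn.1.le ihn.2
      have h3 := (hall (orderOf (α' * ρ) - 1)).1
      rw [Nat.sub_add_cancel (orderOf_pos _), pow_orderOf_eq_one] at h3
      exact lt_irrefl _ h3
    -- With the new chord, the walk that would reach `b'` is sent back to `b`, so the half-open arc
    -- is stable.
    · rintro k ⟨hk1, hk2⟩
      rw [Perm.mul_apply, Perm.mul_apply]
      rcases hstep k hk1 hk2 with h3 | h3
      · rw [h3, hα'b', swap_apply_right]
        exact ⟨le_rfl, hbb⟩
      · rw [swap_apply_of_ne_of_ne]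
        · exact ⟨h3.1.le, h3.2⟩
        · intro h'; rw [h'] at h3; omega
        · intro h'; rw [h'] at h3; omega

end CyclicOrder

/-! ### Cutting the annulus along a spoke -/

section CutPosition

variable {p q : ℕ}

theorem val_finRotate {n : ℕ} (t : Fin n) :
    (finRotate n t).val = if t.val + 1 = n then 0 else t.val + 1 := by
  obtain _ | n := n
  · exact t.elim0
  · rw [coe_finRotate]
    simp [Fin.ext_iff, Fin.val_last]

theorem val_annularRotation (z : Fin (p + q)) :
    (annularRotation p q z).val =
      if z.val < p then (if z.val + 1 = p then 0 else z.val + 1)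
      else if z.val + 1 = p + q then p else z.val + 1 := by
  refine Fin.addCases (fun t => ?_) (fun t => ?_) z
  · rw [annularRotation_castAdd]
    simp only [Fin.val_castAdd, val_finRotate, Fin.is_lt, if_true]
  · rw [annularRotation_natAdd]
    simp only [Fin.val_natAdd, val_finRotate]
    split_ifs <;> omega

theorem cutPos_eq {x y : Fin (p + q)} (hx : x.val < p) (hy : p ≤ y.val) (z : Fin (p + q)) :
    cutPos p q x y z =
      if z.val < p then (if x.val ≤ z.val then z.val - x.val else z.val + p - x.val)
      else if y.val ≤ z.val then p + (z.val - y.val) else p + (z.val + q - y.val) := by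
  have := x.2; have := y.2; have := z.2
  unfold cutPos
  split_ifs with h1 h2 h3
  · rw [show z.val + p - x.val = z.val - x.val + p by omega, Nat.add_mod_right,
      Nat.mod_eq_of_lt (by omega)]
  · rw [Nat.mod_eq_of_lt (by omega)]
  · rw [show z.val + q - y.val = z.val - y.val + q by omega, Nat.add_mod_right,
      Nat.mod_eq_of_lt (by omega)]
  · rw [Nat.mod_eq_of_lt (by omega)]

/-- The transposition joins the two circles: the inner predecessor of `x` is now followed by `y`,
and the outer predecessor of `y` by `x`. This is the boundary order of the cut annulus. -/
theorem isCyclicEnumeration_cutPos {x y : Fin (p + q)} (hx : x.val < p) (hy : p ≤ y.val) :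
    IsCyclicEnumeration (cutPos p q x y) (Equiv.swap x y * annularRotation p q) := by
  have hx2 := x.2
  have hy2 := y.2
  have hlt : ∀ z, cutPos p q x y z < p + q := by
    intro z
    have := z.2
    rw [cutPos_eq hx hy]
    split_ifs <;> omega
  have hstep : ∀ z, cutPos p q x y ((Equiv.swap x y * annularRotation p q) z) =
      cutPos p q x y z + 1 ∨ cutPos p q x y ((Equiv.swap x y * annularRotation p q) z) = 0 ∧
        cutPos p q x y z + 1 = p + q := by
    intro z
    have hz := z.2
    have hσ := val_annularRotation z
    rw [Equiv.Perm.mul_apply]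
    set w := annularRotation p q z
    have hw := w.2
    rw [Equiv.swap_apply_def]
    simp only [Fin.ext_iff] at *
    simp only [cutPos_eq hx hy]
    by_cases hzp : z.val < p
    · simp only [hzp, if_true] at hσ ⊢
      split_ifs at hσ ⊢ <;> omega
    · simp only [hzp, if_false] at hσ ⊢
      split_ifs at hσ ⊢ <;> omega
  refine ⟨fun z w hzw => ?_, fun z w hzw => ?_, fun z hz => ?_⟩
  · have := z.2
    have := w.2
    rw [cutPos_eq hx hy, cutPos_eq hx hy] at hzw
    ext
    split_ifs at hzw <;> omega
  · have := hlt w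
    rcases hstep z with h | h <;> omega
  · refine ⟨(Equiv.swap x y * annularRotation p q).symm z, ?_⟩
    have := hstep ((Equiv.swap x y * annularRotation p q).symm z)
    rw [Equiv.apply_symm_apply] at this
    omega

end CutPosition

/-! ### Counting labellings of an annular pairing -/

section Genus

variable {p q : ℕ} {π : Equiv.Perm (Fin (p + q))}

theorem even_of_isPairing {n : ℕ} {π : Equiv.Perm (Fin n)} (hπ : IsPairing π) : Even n := by
  have := even_card_of_mem_involutionsOn (mem_involutionsOn_univ.2 hπ)
  simpa using this

/-- Removing the spoke from `π` makes `x` and `y` fixed points, which cannot be ends of crossing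
chords; the conditions excluding them are then automatic. -/
theorem hasCrossing_mul_swap_iff (hπ : IsPairing π) {x y : Fin (p + q)} (hxy : IsSpoke p q π x y) :
    HasCrossing (cutPos p q x y) (π * Equiv.swap x y) ↔
      ∃ a b : Fin (p + q), (a ≠ x ∧ a ≠ y ∧ b ≠ x ∧ b ≠ y) ∧
        cutPos p q x y a < cutPos p q x y b ∧
        cutPos p q x y b < cutPos p q x y (π a) ∧
        cutPos p q x y (π a) < cutPos p q x y (π b) := by
  obtain ⟨-, -, rfl⟩ := hxy
  have hx : (π * Equiv.swap x (π x)) x = x := by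
    rw [Equiv.Perm.mul_apply, Equiv.swap_apply_left, (hπ x).2]
  have hy : (π * Equiv.swap x (π x)) (π x) = π x := by
    rw [Equiv.Perm.mul_apply, Equiv.swap_apply_right]
  have happ : ∀ z, z ≠ x → z ≠ π x → (π * Equiv.swap x (π x)) z = π z := by
    intro z hz1 hz2
    rw [Equiv.Perm.mul_apply, Equiv.swap_apply_of_ne_of_ne hz1 hz2]
  constructor
  · rintro ⟨a, b, hab, hba, hab'⟩
    have h1 : a ≠ x := by rintro rfl; rw [hx] at hba; omega
    have h2 : a ≠ π x := by rintro rfl; rw [hy] at hba; omega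
    have h3 : b ≠ x := by rintro rfl; rw [hx] at hab'; omega
    have h4 : b ≠ π x := by rintro rfl; rw [hy] at hab'; omega
    rw [happ a h1 h2] at hba hab'
    rw [happ b h3 h4] at hab'
    exact ⟨a, b, ⟨h1, h2, h3, h4⟩, hab, hba, hab'⟩
  · rintro ⟨a, b, ⟨h1, h2, h3, h4⟩, hab, hba, hab'⟩
    refine ⟨a, b, hab, ?_, ?_⟩
    · rwa [happ a h1 h2]
    · rwa [happ a h1 h2, happ b h3 h4]

theorem mul_swap_mem_of_isSpoke (hπ : IsPairing π) {x y : Fin (p + q)} (hxy : IsSpoke p q π x y) :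
    π * Equiv.swap x y ∈ involutionsOn ((Finset.univ.erase x).erase y) := by
  obtain ⟨-, -, rfl⟩ := hxy
  exact mul_swap_mem_involutionsOn_erase (mem_involutionsOn_univ.2 hπ) x

theorem half_card_erase_spoke {x y : Fin (p + q)} (hxy : IsSpoke p q π x y) :
    (p + q) / 2 = ((Finset.univ.erase x).erase y).card / 2 + 1 := by
  have h := card_erase_erase (Finset.mem_univ x) (Finset.mem_univ y) (by
    rintro rfl
    exact absurd hxy.1 (not_lt.2 hxy.2.1))
  rw [Finset.card_univ, Fintype.card_fin] at h
  omega

variable {M : Type*} [Fintype M] [DecidableEq M]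

/-- Inserting the square of the transposition moves the spoke from the pairing to the rotation. -/
theorem card_invariantFunctions_annularRotation_mul (π : Equiv.Perm (Fin (p + q)))
    (x y : Fin (p + q)) :
    (invariantFunctions M (annularRotation p q * π)).card =
      (invariantFunctions M
        (π * Equiv.swap x y * (Equiv.swap x y * annularRotation p q))).card := by
  rw [card_invariantFunctions_mul_comm]
  simp [mul_assoc]

variable [AddCommGroup M]

theorem IsNCAnnularPairing.card_invariantFunctions (hπ : IsNCAnnularPairing p q π) :
    (invariantFunctions M (annularRotation p q * π)).card = Fintype.card M ^ ((p + q) / 2) := by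
  obtain ⟨h1, ⟨x, y, hxy⟩, h2⟩ := hπ
  have : Nonempty (Fin (p + q)) := ⟨x⟩
  rw [card_invariantFunctions_annularRotation_mul π x y,
    (isCyclicEnumeration_cutPos hxy.1 hxy.2.1).card_invariantFunctions_involution_mul_eq
      (mul_swap_mem_of_isSpoke h1 hxy) (mt (hasCrossing_mul_swap_iff h1 hxy).1 (h2 x y hxy)),
    half_card_erase_spoke hxy]

theorem card_invariantFunctions_le_of_not_isNCAnnularPairing (hπ : IsPairing π)
    (hs : ∃ x y, IsSpoke p q π x y) (hnc : ¬ IsNCAnnularPairing p q π) :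
    (invariantFunctions M (annularRotation p q * π)).card * Fintype.card M ≤
      Fintype.card M ^ ((p + q) / 2) := by
  -- The cut is made along a spoke at which the non-crossing condition fails; the exact count in the
  -- non-crossing case may use any spoke.
  obtain ⟨x, y, hxy, hc⟩ : ∃ x y, IsSpoke p q π x y ∧
      HasCrossing (cutPos p q x y) (π * Equiv.swap x y) := by
    by_contra hcon
    push Not at hcon
    exact hnc ⟨hπ, hs, fun x y hxy => mt (hasCrossing_mul_swap_iff hπ hxy).2 (hcon x y hxy)⟩
  have : Nonempty (Fin (p + q)) := ⟨x⟩
  rw [card_invariantFunctions_annularRotation_mul π x y, half_card_erase_spoke hxy,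
    pow_succ]
  exact Nat.mul_le_mul_right _
    ((isCyclicEnumeration_cutPos hxy.1 hxy.2.1).card_invariantFunctions_involution_mul_le
      (mul_swap_mem_of_isSpoke hπ hxy) hc)

end Genus

/-! ### Normalization and the limit -/

section Limit

theorem tendsto_card_invariantFunctions {p q : ℕ} {π : Equiv.Perm (Fin (p + q))}
    (hπ : IsPairing π) (hs : ∃ x y, IsSpoke p q π x y) :
    Tendsto (fun N : ℕ => ((Real.sqrt N)⁻¹) ^ (p + q) *
      ((invariantFunctions (Fin N) (annularRotation p q * π)).card : ℝ)) atTop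
      (𝓝 (if IsNCAnnularPairing p q π then 1 else 0)) := by
  -- A pairing forces `p + q` to be even, so the normalization is an integral power of `N`.
  obtain ⟨h, hh⟩ := even_of_isPairing hπ
  have hpow : ∀ N : ℕ, ((Real.sqrt N)⁻¹) ^ (p + q) = ((N : ℝ) ^ h)⁻¹ := by
    intro N
    rw [congrArg (((Real.sqrt N)⁻¹) ^ ·) (hh.trans (two_mul h).symm), pow_mul, inv_pow,
      Real.sq_sqrt (Nat.cast_nonneg N), inv_pow]
  have hdiv : (p + q) / 2 = h := by omega
  simp only [hpow]
  split_ifs with hnc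
  · refine tendsto_const_nhds.congr' ?_
    filter_upwards [eventually_ge_atTop 1] with N hN
    -- The counting lemmas need an additive group structure on `Fin N`, hence `N ≥ 1`.
    have : NeZero N := ⟨by omega⟩
    have hN0 : (N : ℝ) ≠ 0 := by exact_mod_cast (by omega : N ≠ 0)
    rw [hnc.card_invariantFunctions, hdiv, Fintype.card_fin, Nat.cast_pow,
      inv_mul_cancel₀ (pow_ne_zero _ hN0)]
  · refine squeeze_zero' (Eventually.of_forall fun N =>
      mul_nonneg (by positivity) (Nat.cast_nonneg _)) ?_
      tendsto_inv_atTop_nhds_zero_nat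
    filter_upwards [eventually_ge_atTop 1] with N hN
    have : NeZero N := ⟨by omega⟩
    have hN0 : (0 : ℝ) < N := by exact_mod_cast hN
    have hle := card_invariantFunctions_le_of_not_isNCAnnularPairing (M := Fin N) hπ hs hnc
    rw [Fintype.card_fin, hdiv] at hle
    have hle' : ((invariantFunctions (Fin N) (annularRotation p q * π)).card : ℝ) * N ≤
        (N : ℝ) ^ h := by exact_mod_cast hle
    rw [inv_mul_le_iff₀ (by positivity), ← div_eq_mul_inv, le_div_iff₀ hN0]
    exact hle'

theorem kappa₂_const_mul {Ω : Type*} [MeasurableSpace Ω] (P : Measure Ω) (a b : ℂ)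
    (f g : Ω → ℂ) : kappa₂ P (fun ω => a * f ω) (fun ω => b * g ω) = a * b * kappa₂ P f g := by
  simp only [kappa₂, mul_mul_mul_comm a _ b, integral_const_mul]
  ring

end Limit

theorem proposition3p1 {Ω : ℕ → Type*} [∀ N, MeasurableSpace (Ω N)]
    (P : ∀ N, Measure (Ω N)) [∀ N, IsProbabilityMeasure (P N)]
    (γ : ℝ) (hγ : γ ∈ Set.Icc (-1 : ℝ) 1)
    (X : ∀ N, Ω N → Matrix (Fin N) (Fin N) ℂ)
    (hX : ∀ N, IsComplexElliptic γ (P N) (X N))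
    (p q : ℕ) (hp : 1 ≤ p) (hq : 1 ≤ q) (τ : Fin (p + q) → Letter)
    (W₁ W₂ : ∀ N, Ω N → ℂ)
    (hW₁ : ∀ N ω, W₁ N ω =
      traceWord (normalizedMatrix (X N ω)) fun t : Fin p => τ (Fin.castAdd q t))
    (hW₂ : ∀ N ω, W₂ N ω =
      traceWord (normalizedMatrix (X N ω)) fun t : Fin q => τ (Fin.natAdd p t)) :
    (∀ N, MemLp (W₁ N) 2 (P N) ∧ MemLp (W₂ N) 2 (P N)) ∧
      Tendsto (fun N => kappa₂ (P N) (W₁ N) (W₂ N)) atTop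
        (𝓝 (((∑ π ∈ NC₂ p q, γ ^ sameTypePairs π τ : ℝ)) : ℂ)) := by
  have e₁ : ∀ N, W₁ N = fun ω => (((Real.sqrt N)⁻¹ : ℝ) : ℂ) ^ p *
      traceWord (X N ω) fun t : Fin p => τ (Fin.castAdd q t) := fun N => by
    funext ω
    rw [hW₁, normalizedMatrix, traceWord_smul]
  have e₂ : ∀ N, W₂ N = fun ω => (((Real.sqrt N)⁻¹ : ℝ) : ℂ) ^ q *
      traceWord (X N ω) fun t : Fin q => τ (Fin.natAdd p t) := fun N => by
    funext ω
    rw [hW₂, normalizedMatrix, traceWord_smul]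
  refine ⟨fun N => ⟨?_, ?_⟩, ?_⟩
  · rw [e₁]
    exact ((hX N).memLp_traceWord hp _ 2 (by simp)).const_mul _
  · rw [e₂]
    exact ((hX N).memLp_traceWord hq _ 2 (by simp)).const_mul _
  have hκ : ∀ N, kappa₂ (P N) (W₁ N) (W₂ N) =
      ((∑ π with IsPairing π ∧ ∃ x y, IsSpoke p q π x y, γ ^ sameTypePairs π τ *
        (((Real.sqrt N)⁻¹) ^ (p + q) *
          ((invariantFunctions (Fin N) (annularRotation p q * π)).card : ℝ)) : ℝ) : ℂ) := by
    intro N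
    rw [e₁, e₂, kappa₂_const_mul, (hX N).kappa₂_traceWord hp hq, Finset.mul_sum, ← pow_add]
    push_cast
    exact Finset.sum_congr rfl fun π _ => by ring
  have hsum : ∑ π ∈ NC₂ p q, γ ^ sameTypePairs π τ =
      ∑ π with IsPairing π ∧ ∃ x y, IsSpoke p q π x y, γ ^ sameTypePairs π τ *
        if IsNCAnnularPairing p q π then (1 : ℝ) else 0 := by
    simp only [mul_ite, mul_one, mul_zero]
    rw [← Finset.sum_filter, Finset.filter_filter]
    refine Finset.sum_congr (Finset.filter_congr fun π _ => ?_) fun _ _ => rfl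
    exact ⟨fun h => ⟨⟨h.1, h.2.1⟩, h⟩, fun h => h.2⟩
  simp only [hκ, hsum]
  refine (Complex.continuous_ofReal.tendsto _).comp (tendsto_finsetSum _ fun π hπ => ?_)
  obtain ⟨h1, h2⟩ := (Finset.mem_filter.1 hπ).2
  exact (tendsto_card_invariantFunctions h1 h2).const_mul _
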